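/- Let $\Omega\subset\mathbb R^3$ be a bounded, connected, open set with smooth boundary, $\mathbf n$ its outward unit normal, $d\mathbf n$ the differential of the Gauss map $\mathbf n:\partial\Omega\to S^2$, $dS$ the two-dimensional Hausdorff measure on $\partial\Omega$, and $\nu>0$. Let $L^2_{\sigma,\tan}(\Omega)$ be the space of square-integrable divergence-free vector fields on $\Omega$ tangent to $\partial\Omega$ (zero normal trace), $H^1_{\sigma,\tan}(\Omega)$ the fields in it with square-integrable first weak derivatives, and $C^\infty_{\sigma,\tan}(\overline\Omega)$ the divergence-free fields, smooth up to the boundary, tangent to $\partial\Omega$. For matrices put $A:B=\sum_{i,j}A_{ij}B_{ij}$. A weak solution of the Navier--Stokes equations with viscosity $\nu$, Navier boundary conditions with friction coefficient $\alpha\in C^0(\partial\Omega)$, namely $u\cdot\mathbf n=0$ and $[(2Su)\mathbf n+\alpha u]_{\tan}=0$ on $\partial\Omega$, where $Su=\frac12(Du+(Du)^t)$, and initial velocity $u_0\in L^2_{\sigma,\tan}(\Omega)$, is a map $u:[0,\infty)\to L^2_{\sigma,\tan}(\Omega)$ that is weakly continuous, bounded in $L^2$ on $[0,T)$ for every $T>0$,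 belongs to $L^2_{\mathrm{loc}}((0,\infty);H^1_{\sigma,\tan}(\Omega))$, has $\partial_t u\in L^{4/3}_{\mathrm{loc}}((0,\infty);(H^1_{\sigma,\tan}(\Omega))')$, and satisfies, for every $\Phi\in C^\infty_c([0,\infty);C^\infty_{\sigma,\tan}(\overline\Omega))$ (the integrals being convergent), $$\int_0^\infty\!\!\int_\Omega\{\partial_t\Phi\cdot u+[(u\cdot\nabla)\Phi]\cdot u\}\,dx\,dt+\int_\Omega\Phi(0,x)\cdot u_0(x)\,dx=\nu\int_0^\infty\Big(\int_\Omega D\Phi:Du\,dx+\int_{\partial\Omega}\Phi\cdot[\alpha u-d\mathbf n(u)]\,dS\Big)dt .$$ Let $\mathrm{Ker}\,S$ be the closed subspace of those $w\in L^2_{\sigma,\tan}(\Omega)$ with $Sw=0$ in the sense of distributions on $\Omega$, and $\mathrm{Proj}_{\mathrm{Ker}\,S}$ the $L^2$-orthogonal projection onto it. Suppose that $\alpha=0$. Then: 1. every $w\in\mathrm{Ker}\,S$, viewed as constant in time, is a weak solution with initial velocity $w$; 2. for every weak solution $u$ with any initial velocity $u_0\in L^2_{\sigma,\tan}(\Omega)$,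 one has $\mathrm{Proj}_{\mathrm{Ker}\,S}\,u(t)=\mathrm{Proj}_{\mathrm{Ker}\,S}\,u_0$ for all $t\ge 0$, and $\mathrm{Proj}_{\mathrm{Ker}\,S}\,u$ is a (stationary) weak solution with initial velocity $\mathrm{Proj}_{\mathrm{Ker}\,S}\,u_0$. -/

import Mathlib

open MeasureTheory Filter Topology
open scoped ContDiff ENNReal

noncomputable section

namespace NavierSlip

/-- Euclidean three-space. -/
abbrev E3 : Type := EuclideanSpace ℝ (Fin 3)

/-! ### The domain and its boundary -/

/-- A bounded, connected, open set with smooth boundary: near each boundary point, after a linear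
isometric change of coordinates, the set is the strict epigraph of a smooth function of the first
two coordinates. -/
structure IsSmoothBoundedDomain (Ω : Set E3) : Prop where
  isOpen : IsOpen Ω
  isConnected : IsConnected Ω
  isBounded : Bornology.IsBounded Ω
  smooth_boundary : ∀ p ∈ frontier Ω, ∃ r > 0, ∃ L : E3 ≃ₗᵢ[ℝ] E3,
    ∃ γ : EuclideanSpace ℝ (Fin 2) → ℝ, ContDiff ℝ ∞ γ ∧
      ∀ x ∈ Metric.ball p r, x ∈ Ω ↔ γ !₂[L x 0, L x 1] < L x 2

/-- `n` is the outward unit normal of `Ω` at `p`: directions making an obtuse angle with `n` point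
into `Ω`, those making an acute angle with `n` point out of `Ω`. At most one vector `n` has this
property. -/
def IsOutwardUnitNormal (Ω : Set E3) (p n : E3) : Prop :=
  ‖n‖ = 1 ∧
  (∀ v : E3, inner ℝ v n < 0 → ∀ᶠ ε : ℝ in 𝓝[>] 0, p + ε • v ∈ Ω) ∧
  (∀ v : E3, 0 < inner ℝ v n → ∀ᶠ ε : ℝ in 𝓝[>] 0, p + ε • v ∉ Ω)

open Classical in
/-- The Gauss map: the outward unit normal at `p` (and `0` at points that have none). -/
def outwardNormal (Ω : Set E3) (p : E3) : E3 :=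
  if h : ∃ n, IsOutwardUnitNormal Ω p n then h.choose else 0

/-- The shape operator `d𝐧_p`: the derivative of the Gauss map along the boundary. The derivative
within the boundary is determined on tangent vectors only; a general vector `v` is first projected
orthogonally to the tangent plane. -/
def shapeOperator (Ω : Set E3) (p v : E3) : E3 :=
  fderivWithin ℝ (outwardNormal Ω) (frontier Ω) p
    (v - (inner ℝ v (outwardNormal Ω p) : ℝ) • outwardNormal Ω p)

/-- The surface measure on `∂Ω`: two-dimensional Hausdorff measure, normalised so that it agrees
with Lebesgue measure on planes. -/
def surfaceMeasure (Ω : Set E3) : Measure E3 :=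
  (Measure.euclideanHausdorffMeasure 2 : Measure E3).restrict (frontier Ω)

/-! ### Function spaces -/

/-- Square-integrable vector fields on `Ω`. -/
abbrev L2 (Ω : Set E3) : Type := Lp E3 2 (volume.restrict Ω)

/-- Square-integrable (Jacobian) matrix fields on `Ω`. -/
abbrev L2Mat (Ω : Set E3) : Type := Lp (E3 →L[ℝ] E3) 2 (volume.restrict Ω)

/-- The Frobenius pairing `A : B = ∑ᵢⱼ Aᵢⱼ Bᵢⱼ` of matrices. -/
def frobenius (A B : E3 →L[ℝ] E3) : ℝ :=
  ∑ i : Fin 3, inner ℝ (A (EuclideanSpace.single i 1)) (B (EuclideanSpace.single i 1))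

/-- The divergence of a differentiable vector field. -/
def divergence (f : E3 → E3) (x : E3) : ℝ :=
  ∑ i : Fin 3, fderiv ℝ f x (EuclideanSpace.single i 1) i

/-- Continuous linear images of the derivative of a test function are square-integrable. -/
lemma memLp_combination_fderiv (Ω : Set E3) {φ : E3 → ℝ} (hφ : ContDiff ℝ ∞ φ)
    (hc : HasCompactSupport φ) {F : Type*} [NormedAddCommGroup F] [NormedSpace ℝ F]
    (T : (E3 →L[ℝ] ℝ) →L[ℝ] F) :
    MemLp (fun x => T (fderiv ℝ φ x)) 2 (volume.restrict Ω) := by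
  have h1 : Continuous (fun x => T (fderiv ℝ φ x)) :=
    T.continuous.comp (hφ.continuous_fderiv (by simp))
  have h2 : HasCompactSupport (fun x => T (fderiv ℝ φ x)) :=
    (hc.fderiv ℝ).comp_left (map_zero T)
  exact (h1.memLp_of_hasCompactSupport h2).restrict Ω

lemma continuous_integral_inner (Ω : Set E3) {g : E3 → E3} (hg : MemLp g 2 (volume.restrict Ω)) :
    ∃ ℓ : L2 Ω →L[ℝ] ℝ, ∀ u : L2 Ω, ℓ u = ∫ x in Ω, inner ℝ (g x) (u x) := by
  refine ⟨innerSL ℝ (hg.toLp g), fun u => ?_⟩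
  rw [innerSL_apply_apply, L2.inner_def]
  refine integral_congr_ae ?_
  filter_upwards [hg.coeFn_toLp] with x hx
  rw [hx]

lemma exists_clm_fderiv (Ω : Set E3) {φ : E3 → ℝ} (hφ : ContDiff ℝ ∞ φ)
    (hc : HasCompactSupport φ) :
    ∃ ℓ : L2 Ω →L[ℝ] ℝ, ∀ u : L2 Ω, ℓ u = ∫ x in Ω, fderiv ℝ φ x (u x) := by
  let T : (E3 →L[ℝ] ℝ) →ₗ[ℝ] E3 :=
    { toFun := fun f => (InnerProductSpace.toDual ℝ E3).symm f
      map_add' := fun f g => map_add _ f g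
      map_smul' := fun c f => by simp }
  obtain ⟨ℓ, hℓ⟩ := continuous_integral_inner Ω
    (memLp_combination_fderiv Ω hφ hc (LinearMap.toContinuousLinearMap T))
  refine ⟨ℓ, fun u => ?_⟩
  rw [hℓ]
  simp [T]

lemma exists_clm_sym (Ω : Set E3) {φ : E3 → ℝ} (hφ : ContDiff ℝ ∞ φ)
    (hc : HasCompactSupport φ) (v w : E3) :
    ∃ ℓ : L2 Ω →L[ℝ] ℝ, ∀ u : L2 Ω,
      ℓ u = ∫ x in Ω, (inner ℝ (u x) v * fderiv ℝ φ x w + inner ℝ (u x) w * fderiv ℝ φ x v) := by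
  obtain ⟨ℓ, hℓ⟩ := continuous_integral_inner Ω (memLp_combination_fderiv Ω hφ hc
    ((ContinuousLinearMap.apply ℝ ℝ w).smulRight v + (ContinuousLinearMap.apply ℝ ℝ v).smulRight w))
  refine ⟨ℓ, fun u => ?_⟩
  rw [hℓ]
  refine integral_congr_ae (Eventually.of_forall fun x => ?_)
  simp [inner_add_left, inner_smul_left, real_inner_comm, mul_comm]

/-- `L²_{σ,tan}(Ω)`: the square-integrable fields `u` with `div u = 0` in the sense of
distributions and vanishing normal trace. The normal trace of a solenoidal field is the functional
`φ ↦ ∫_Ω u · ∇φ`, `φ ∈ C^∞(Ω̄)`, so both conditions together say that this integral vanishes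
for all such `φ` (those with support in `Ω` express `div u = 0`). -/
def L2SigmaTan (Ω : Set E3) : Submodule ℝ (L2 Ω) where
  carrier := {u | ∀ φ : E3 → ℝ, ContDiff ℝ ∞ φ → HasCompactSupport φ →
    ∫ x in Ω, fderiv ℝ φ x (u x) = 0}
  zero_mem' := fun φ hφ hc => by
    obtain ⟨ℓ, hℓ⟩ := exists_clm_fderiv Ω hφ hc
    rw [← hℓ, map_zero]
  add_mem' := fun {u v} hu hv φ hφ hc => by
    obtain ⟨ℓ, hℓ⟩ := exists_clm_fderiv Ω hφ hc
    rw [← hℓ, map_add, hℓ, hℓ, hu φ hφ hc, hv φ hφ hc, add_zero]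
  smul_mem' := fun c u hu φ hφ hc => by
    obtain ⟨ℓ, hℓ⟩ := exists_clm_fderiv Ω hφ hc
    rw [← hℓ, map_smul, hℓ, hu φ hφ hc, smul_zero]

/-- `G` is the weak Jacobian of `u` in `Ω`. -/
def HasWeakJacobian (Ω : Set E3) (u : L2 Ω) (G : L2Mat Ω) : Prop :=
  ∀ φ : E3 → ℝ, ContDiff ℝ ∞ φ → HasCompactSupport φ → tsupport φ ⊆ Ω → ∀ v : E3,
    ∫ x in Ω, fderiv ℝ φ x v • u x = -∫ x in Ω, φ x • G x v

lemma integrable_smul_L2 (Ω : Set E3) {ψ : E3 → ℝ} (hψ : Continuous ψ)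
    (hc : HasCompactSupport ψ) {F : Type*} [NormedAddCommGroup F] [NormedSpace ℝ F]
    (u : Lp F 2 (volume.restrict Ω)) : IntegrableOn (fun x => ψ x • u x) Ω volume := by
  have h : MemLp ψ 2 (volume.restrict Ω) := (hψ.memLp_of_hasCompactSupport hc).restrict Ω
  exact memLp_one_iff_integrable.1 ((Lp.memLp u).smul h)

lemma integrable_smul_L2Mat (Ω : Set E3) {ψ : E3 → ℝ} (hψ : Continuous ψ)
    (hc : HasCompactSupport ψ) (G : L2Mat Ω) (v : E3) :
    IntegrableOn (fun x => ψ x • G x v) Ω volume := by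
  have := (ContinuousLinearMap.apply ℝ E3 v).integrable_comp (integrable_smul_L2 Ω hψ hc G)
  simpa [IntegrableOn] using this

/-- `H¹_{σ,tan}(Ω)`: the fields in `L²_{σ,tan}(Ω)` with square-integrable weak first derivatives,
each represented by the pair of the field and its weak Jacobian. The norm inherited from the
product is equivalent to the usual one. -/
def H1SigmaTan (Ω : Set E3) : Submodule ℝ (L2 Ω × L2Mat Ω) where
  carrier := {U | U.1 ∈ L2SigmaTan Ω ∧ HasWeakJacobian Ω U.1 U.2}
  zero_mem' := by
    refine ⟨(L2SigmaTan Ω).zero_mem, fun φ hφ hc hs v => ?_⟩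
    have h1 : ∫ x in Ω, fderiv ℝ φ x v • (0 : L2 Ω) x = 0 := by
      refine integral_eq_zero_of_ae ?_
      filter_upwards [Lp.coeFn_zero E3 2 (volume.restrict Ω)] with x hx
      rw [hx]; simp
    have h2 : ∫ x in Ω, φ x • (0 : L2Mat Ω) x v = 0 := by
      refine integral_eq_zero_of_ae ?_
      filter_upwards [Lp.coeFn_zero (E3 →L[ℝ] E3) 2 (volume.restrict Ω)] with x hx
      rw [hx]; simp
    simp only [Prod.fst_zero, Prod.snd_zero, h1, h2, neg_zero]
  add_mem' := fun {U V} hU hV => by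
    refine ⟨(L2SigmaTan Ω).add_mem hU.1 hV.1, fun φ hφ hc hs v => ?_⟩
    have hd : Continuous (fun x => fderiv ℝ φ x v) :=
      (hφ.continuous_fderiv (by simp)).clm_apply continuous_const
    have hdc : HasCompactSupport (fun x => fderiv ℝ φ x v) := hc.fderiv_apply ℝ v
    have h1 : ∫ x in Ω, fderiv ℝ φ x v • (U.1 + V.1 : L2 Ω) x =
        (∫ x in Ω, fderiv ℝ φ x v • U.1 x) + ∫ x in Ω, fderiv ℝ φ x v • V.1 x := by
      rw [← integral_add (integrable_smul_L2 Ω hd hdc U.1) (integrable_smul_L2 Ω hd hdc V.1)]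
      refine integral_congr_ae ?_
      filter_upwards [Lp.coeFn_add U.1 V.1] with x hx
      rw [hx]; simp
    have h2 : ∫ x in Ω, φ x • (U.2 + V.2 : L2Mat Ω) x v =
        (∫ x in Ω, φ x • U.2 x v) + ∫ x in Ω, φ x • V.2 x v := by
      rw [← integral_add (integrable_smul_L2Mat Ω hφ.continuous hc U.2 v)
        (integrable_smul_L2Mat Ω hφ.continuous hc V.2 v)]
      refine integral_congr_ae ?_
      filter_upwards [Lp.coeFn_add U.2 V.2] with x hx
      rw [hx]; simp
    rw [Prod.fst_add, Prod.snd_add, h1, h2, hU.2 φ hφ hc hs v, hV.2 φ hφ hc hs v, neg_add]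
  smul_mem' := fun c U hU => by
    refine ⟨(L2SigmaTan Ω).smul_mem c hU.1, fun φ hφ hc hs v => ?_⟩
    have h1 : ∫ x in Ω, fderiv ℝ φ x v • (c • U.1 : L2 Ω) x =
        c • ∫ x in Ω, fderiv ℝ φ x v • U.1 x := by
      rw [← integral_smul]
      refine integral_congr_ae ?_
      filter_upwards [Lp.coeFn_smul c U.1] with x hx
      rw [hx, Pi.smul_apply, smul_comm]
    have h2 : ∫ x in Ω, φ x • (c • U.2 : L2Mat Ω) x v = c • ∫ x in Ω, φ x • U.2 x v := by
      rw [← integral_smul]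
      refine integral_congr_ae ?_
      filter_upwards [Lp.coeFn_smul c U.2] with x hx
      rw [hx, Pi.smul_apply, smul_apply, smul_comm]
    rw [Prod.smul_fst, Prod.smul_snd, h1, h2, hU.2 φ hφ hc hs v, smul_neg]

/-- `g` is the boundary trace of the Sobolev field `U = (u, Du)`: there are fields smooth up to
the boundary which converge to `u` in `H¹(Ω)` and whose restrictions to `∂Ω` converge to `g` in
`L²(∂Ω)`. -/
def IsBoundaryTrace (Ω : Set E3) (U : L2 Ω × L2Mat Ω) (g : Lp E3 2 (surfaceMeasure Ω)) : Prop :=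
  ∃ f : ℕ → E3 → E3, (∀ k, ContDiff ℝ ∞ (f k)) ∧
    Tendsto (fun k => eLpNorm (fun x => f k x - U.1 x) 2 (volume.restrict Ω)) atTop (𝓝 0) ∧
    Tendsto (fun k => eLpNorm (fun x => fderiv ℝ (f k) x - U.2 x) 2 (volume.restrict Ω))
      atTop (𝓝 0) ∧
    Tendsto (fun k => eLpNorm (fun x => f k x - g x) 2 (surfaceMeasure Ω)) atTop (𝓝 0)

/-- `Ker S`: the fields `u ∈ L²_{σ,tan}(Ω)` whose symmetric gradient
`Su = (Du + (Du)ᵗ)/2` vanishes as a distribution on `Ω`. -/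
def kerS (Ω : Set E3) : Submodule ℝ (L2 Ω) where
  carrier := {u | u ∈ L2SigmaTan Ω ∧ ∀ φ : E3 → ℝ, ContDiff ℝ ∞ φ → HasCompactSupport φ →
    tsupport φ ⊆ Ω → ∀ v w : E3,
      ∫ x in Ω, (inner ℝ (u x) v * fderiv ℝ φ x w + inner ℝ (u x) w * fderiv ℝ φ x v) = 0}
  zero_mem' := by
    refine ⟨(L2SigmaTan Ω).zero_mem, fun φ hφ hc _ v w => ?_⟩
    obtain ⟨ℓ, hℓ⟩ := exists_clm_sym Ω hφ hc v w
    rw [← hℓ, map_zero]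
  add_mem' := fun {u₁ u₂} h₁ h₂ => by
    refine ⟨(L2SigmaTan Ω).add_mem h₁.1 h₂.1, fun φ hφ hc hs v w => ?_⟩
    obtain ⟨ℓ, hℓ⟩ := exists_clm_sym Ω hφ hc v w
    rw [← hℓ, map_add, hℓ, hℓ, h₁.2 φ hφ hc hs v w, h₂.2 φ hφ hc hs v w, add_zero]
  smul_mem' := fun c u h => by
    refine ⟨(L2SigmaTan Ω).smul_mem c h.1, fun φ hφ hc hs v w => ?_⟩
    obtain ⟨ℓ, hℓ⟩ := exists_clm_sym Ω hφ hc v w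
    rw [← hℓ, map_smul, hℓ, h.2 φ hφ hc hs v w, smul_zero]

lemma isClosed_kerS (Ω : Set E3) : IsClosed (kerS Ω : Set (L2 Ω)) := by
  have h : (kerS Ω : Set (L2 Ω)) =
      {u | ∀ φ : E3 → ℝ, ContDiff ℝ ∞ φ → HasCompactSupport φ →
        ∫ x in Ω, fderiv ℝ φ x (u x) = 0} ∩
      {u | ∀ φ : E3 → ℝ, ContDiff ℝ ∞ φ → HasCompactSupport φ → tsupport φ ⊆ Ω → ∀ v w : E3,
        ∫ x in Ω, (inner ℝ (u x) v * fderiv ℝ φ x w + inner ℝ (u x) w * fderiv ℝ φ x v) = 0} :=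
    rfl
  rw [h]
  refine IsClosed.inter ?_ ?_
  · simp only [Set.ofPred_forall]
    refine isClosed_iInter fun φ => isClosed_iInter fun hφ => isClosed_iInter fun hc => ?_
    obtain ⟨ℓ, hℓ⟩ := exists_clm_fderiv Ω hφ hc
    simp only [← hℓ]
    exact isClosed_eq ℓ.continuous continuous_const
  · simp only [Set.ofPred_forall]
    refine isClosed_iInter fun φ => isClosed_iInter fun hφ => isClosed_iInter fun hc =>
      isClosed_iInter fun hs => isClosed_iInter fun v => isClosed_iInter fun w => ?_
    obtain ⟨ℓ, hℓ⟩ := exists_clm_sym Ω hφ hc v w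
    simp only [← hℓ]
    exact isClosed_eq ℓ.continuous continuous_const

instance instCompleteSpaceKerS (Ω : Set E3) : CompleteSpace (kerS Ω) :=
  (isClosed_kerS Ω).completeSpace_coe

/-- The `L²`-orthogonal projection onto `Ker S`. -/
def projKerS (Ω : Set E3) (u : L2 Ω) : L2 Ω := (kerS Ω).starProjection u

/-! ### Weak solutions -/

/-- Test fields `Φ ∈ C_c^∞([0,∞); C^∞_{σ,tan}(Ω̄))`, as restrictions of smooth maps on
`ℝ × ℝ³`. -/
structure IsTestField (Ω : Set E3) (Φ : ℝ → E3 → E3) : Prop where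
  smooth : ContDiff ℝ ∞ (fun q : ℝ × E3 => Φ q.1 q.2)
  support : ∃ T : ℝ, ∀ t, T ≤ t → ∀ x, Φ t x = 0
  solenoidal : ∀ t, 0 ≤ t → ∀ x ∈ Ω, divergence (Φ t) x = 0
  tangent : ∀ t, 0 ≤ t → ∀ x ∈ frontier Ω, inner ℝ (Φ t x) (outwardNormal Ω x) = 0

/-- `∂ₜu ∈ L^{4/3}_loc((0,∞); (H¹_{σ,tan}(Ω))')`, where `∂ₜu` is the time derivative in the sense
of distributions on `(0,∞)` with values in the dual space; a field `u ∈ L²` acts on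
`H¹_{σ,tan}(Ω)` by the `L²` inner product. -/
def HasTimeDerivative (Ω : Set E3) (u : ℝ → L2 Ω) : Prop :=
  ∃ F : ℝ → (H1SigmaTan Ω →L[ℝ] ℝ),
    (∀ a b : ℝ, 0 < a → a < b → MemLp F (4 / 3) (volume.restrict (Set.Icc a b))) ∧
    ∀ η : ℝ → ℝ, ContDiff ℝ ∞ η → HasCompactSupport η → tsupport η ⊆ Set.Ioi 0 →
      ∀ V : H1SigmaTan Ω,
        ∫ t in Set.Ioi (0 : ℝ), deriv η t * inner ℝ (u t) V.1.1 =
          -∫ t in Set.Ioi (0 : ℝ), η t * F t V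

/-- The viscous form `∫_Ω DΦ : Du dx + ∫_{∂Ω} Φ · [α u - d𝐧(u)] dS`, for a field `U = (u, Du)`
with boundary trace `g`. -/
def viscousForm (Ω : Set E3) (α : E3 → ℝ) (Φ : E3 → E3) (U : L2 Ω × L2Mat Ω)
    (g : Lp E3 2 (surfaceMeasure Ω)) : ℝ :=
  (∫ x in Ω, frobenius (fderiv ℝ Φ x) (U.2 x)) +
    ∫ x, inner ℝ (Φ x) (α x • g x - shapeOperator Ω x (g x)) ∂(surfaceMeasure Ω)

/-- `u` (considered for times `t ≥ 0`) is a weak solution of the Navier–Stokes equations in `Ω`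
with viscosity `ν`, friction coefficient `α` and initial velocity `u₀`. Here `U t = (u t, Du t)`
and `g t` is the boundary trace of `u t`, for almost every `t > 0`. -/
structure IsWeakSolution (Ω : Set E3) (ν : ℝ) (α : E3 → ℝ) (u₀ : L2 Ω) (u : ℝ → L2 Ω) :
    Prop where
  initial_mem : u₀ ∈ L2SigmaTan Ω
  mem : ∀ t, 0 ≤ t → u t ∈ L2SigmaTan Ω
  weakly_continuous : ∀ w : L2 Ω, ContinuousOn (fun t => (inner ℝ w (u t) : ℝ)) (Set.Ici 0)
  locally_bounded : ∀ T : ℝ, 0 < T → ∃ C : ℝ, ∀ᵐ t ∂(volume.restrict (Set.Ico 0 T)), ‖u t‖ ≤ C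
  time_derivative : HasTimeDerivative Ω u
  weak_form : ∃ (U : ℝ → H1SigmaTan Ω) (g : ℝ → Lp E3 2 (surfaceMeasure Ω)),
    (∀ᵐ t ∂(volume.restrict (Set.Ioi (0 : ℝ))), (U t).1.1 = u t) ∧
    (∀ a b : ℝ, 0 < a → a < b → MemLp U 2 (volume.restrict (Set.Icc a b))) ∧
    (∀ᵐ t ∂(volume.restrict (Set.Ioi (0 : ℝ))), IsBoundaryTrace Ω (U t).1 (g t)) ∧
    ∀ Φ : ℝ → E3 → E3, IsTestField Ω Φ →
      IntegrableOn (fun t => viscousForm Ω α (Φ t) (U t).1 (g t)) (Set.Ioi 0) volume ∧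
      (∫ t in Set.Ioi (0 : ℝ), ∫ x in Ω,
          (inner ℝ (deriv (fun s => Φ s x) t) (u t x) +
            inner ℝ (fderiv ℝ (Φ t) x (u t x)) (u t x))) +
        ∫ x in Ω, inner ℝ (Φ 0 x) (u₀ x) =
      ν * ∫ t in Set.Ioi (0 : ℝ), viscousForm Ω α (Φ t) (U t).1 (g t)

end NavierSlip

end

open MeasureTheory Filter Topology
open scoped ContDiff ENNReal

noncomputable section

namespace NavierSlip

/-! ### Area formula for Hausdorff measure. -/

section AreaFormula

open Measure Module
open scoped NNReal

/-! An element of Ker S is an infinitesimal rigid motion W(x) = Ax + b with A antisymmetric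
(`exists_affine_of_mem_kerS`: mollify, note that a vanishing symmetric gradient forces the second
derivative to vanish, pass to the limit, and glue by connectedness). Its vanishing normal trace
makes W tangent to the boundary pointwise (`tangent_of_mem_kerS`).

Frictionless slip does not see such fields. On one side, A : Du = div(-Au), so the divergence
theorem turns the bulk viscous term into the boundary integral of u · A𝐧. On the other,
differentiating W · 𝐧 = 0 along the boundary gives W · d𝐧(u) = u · A𝐧. For α = 0 the two cancel,
which makes the viscous form vanish when W is the test field (`viscousForm_rigid_left`). By symmetry
of d𝐧 it also vanishes when W is the solution and the test field is tangent
(`viscousForm_rigid_right`). The convective term of W against a solenoidal tangent field integrates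
to zero (`integral_convective_rigid`). Hence W is a stationary solution.

For an arbitrary weak solution u, test with η(t)W. The viscous form vanishes, and the convective
integrand η Au · u vanishes pointwise by antisymmetry. What remains is ∫ η' ⟨W, u⟩ dt + η(0) ⟨W, u₀⟩
= 0, so ⟨W, u(t)⟩ is constant for almost every t, and for every t ≥ 0 by weak continuity
(`IsWeakSolution.inner_kerS_eq`). Thus the projection of u(t) is that of u₀, and being an element of
Ker S it is itself a stationary solution.

The analytic base is the divergence theorem for Hausdorff surface measure: an area formula
identifies that measure in graph charts, a volume-preserving straightening of the boundary reduces
the local statement to the fundamental theorem of calculus, and a partition of unity globalises it.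
-/

theorem euclideanHausdorffMeasure_image_le_of_edist_le {X Y Z : Type*}
    [EMetricSpace Y] [MeasurableSpace Y] [BorelSpace Y]
    [EMetricSpace Z] [MeasurableSpace Z] [BorelSpace Z]
    {f : X → Y} {g : X → Z} {s : Set X} {K : ℝ≥0} (d : ℕ)
    (h : ∀ x ∈ s, ∀ y ∈ s, edist (f x) (f y) ≤ K * edist (g x) (g y)) :
    (μHE[d] : Measure Y) (f '' s) ≤ (K : ℝ≥0∞) ^ d * (μHE[d] : Measure Z) (g '' s) := by
  classical
  rcases s.eq_empty_or_nonempty with rfl | ⟨x₀, hx₀⟩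
  · simp
  have : Nonempty X := ⟨x₀⟩
  -- On s the map f factors through g, because g x = g y forces f x = f y. The factor f ∘ k is
  -- K-Lipschitz on the image of g, and Lipschitz maps scale d-dimensional measure by at most K ^ d.
  let k := Function.invFunOn g s
  have hk : ∀ z ∈ g '' s, k z ∈ s ∧ g (k z) = z := fun z hz =>
    ⟨Function.invFunOn_mem hz, Function.invFunOn_eq hz⟩
  have himg : f '' s = (f ∘ k) '' (g '' s) := by
    ext y
    constructor
    · rintro ⟨x, hx, rfl⟩
      refine ⟨g x, ⟨x, hx, rfl⟩, ?_⟩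
      have h1 := hk (g x) ⟨x, hx, rfl⟩
      have h2 := h _ h1.1 _ hx
      rw [h1.2, edist_self, mul_zero] at h2
      exact edist_le_zero.1 h2
    · rintro ⟨z, hz, rfl⟩
      exact ⟨k z, (hk z hz).1, rfl⟩
  have hL : LipschitzOnWith K (f ∘ k) (g '' s) := by
    intro z hz z' hz'
    have := h _ (hk z hz).1 _ (hk z' hz').1
    rwa [(hk z hz).2, (hk z' hz').2] at this
  rw [himg, euclideanHausdorffMeasure_def, euclideanHausdorffMeasure_def, Measure.smul_apply,
    Measure.smul_apply, ENNReal.smul_def, ENNReal.smul_def, smul_eq_mul, smul_eq_mul,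
    mul_left_comm]
  have := hL.hausdorffMeasure_image_le (d := d) (Nat.cast_nonneg d)
  rw [ENNReal.rpow_natCast] at this
  gcongr

/-- By second countability, countably many of the neighbourhoods cover the space. Making them
disjoint cuts any measurable set into pieces on which the hypothesis applies, and the inequalities
are summed. -/
theorem measure_le_of_locally_le {X : Type*} [TopologicalSpace X] [SecondCountableTopology X]
    [MeasurableSpace X] [OpensMeasurableSpace X] {μ ν : Measure X}
    (h : ∀ x, ∃ V ∈ 𝓝 x, ∀ s ⊆ V, MeasurableSet s → μ s ≤ ν s) : μ ≤ ν := by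
  choose V hV hle using h
  obtain ⟨t, htc, ht⟩ := TopologicalSpace.countable_cover_nhds
    (fun x => interior_mem_nhds.2 (hV x))
  rcases t.eq_empty_or_nonempty with rfl | hne
  · have : IsEmpty X := by
      rw [← Set.univ_eq_empty_iff, ← ht]; simp
    rw [Measure.eq_zero_of_isEmpty μ]
    exact Measure.zero_le ν
  obtain ⟨f, rfl⟩ := htc.exists_eq_range hne
  rw [Set.biUnion_range] at ht
  refine Measure.le_iff.2 fun s hs => ?_
  set D := disjointed fun n => interior (V (f n))
  have hDm : ∀ n, MeasurableSet (D n) :=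
    MeasurableSet.disjointed fun n => isOpen_interior.measurableSet
  have hDu : ⋃ n, D n = Set.univ := by rw [iUnion_disjointed, ht]
  have hdis : Pairwise (Function.onFun Disjoint fun n => s ∩ D n) := fun i j hij =>
    (disjoint_disjointed _ hij).mono Set.inter_subset_right Set.inter_subset_right
  have hs' : s = ⋃ n, s ∩ D n := by rw [← Set.inter_iUnion, hDu, Set.inter_univ]
  rw [hs', measure_iUnion hdis fun n => hs.inter (hDm n),
    measure_iUnion hdis fun n => hs.inter (hDm n)]
  refine ENNReal.tsum_le_tsum fun n => hle (f n) _ ?_ (hs.inter (hDm n))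
  exact Set.inter_subset_right.trans ((disjointed_subset _ n).trans interior_subset)

variable {U V : Type*} [NormedAddCommGroup U] [InnerProductSpace ℝ U] [FiniteDimensional ℝ U]
  [NormedAddCommGroup V] [InnerProductSpace ℝ V]

/-- The Jacobian factor is the square root of a Gram determinant, whose entries depend continuously
on the map. -/
theorem continuous_normDet {X : Type*} [TopologicalSpace X] {A : X → U →L[ℝ] V}
    (hA : Continuous A) : Continuous fun x => (A x).toLinearMap.normDet := by
  have h : (fun x => (A x).toLinearMap.normDet) = fun x =>
      √((Matrix.gram ℝ fun i => A x (stdOrthonormalBasis ℝ U i)).det) := by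
    ext x
    have := (A x).toLinearMap.normDet_sq_eq_det_gram (stdOrthonormalBasis ℝ U)
    simp only [RCLike.ofReal_real_eq_id, id_eq, ContinuousLinearMap.coe_coe] at this
    rw [← this, Real.sqrt_sq (LinearMap.normDet_nonneg _)]
  rw [h]
  refine Real.continuous_sqrt.comp (Continuous.matrix_det ?_)
  refine continuous_matrix fun i j => ?_
  simp only [Matrix.gram_apply]
  fun_prop

variable [MeasurableSpace U] [BorelSpace U] [MeasurableSpace V] [BorelSpace V]

/-- Area formula for an injective `C¹` immersion. -/
theorem euclideanHausdorffMeasure_image_eq_lintegral {Γ : U → V} (hΓ : ContDiff ℝ 1 Γ)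
    (hinj : Function.Injective Γ) (himm : ∀ y h, ‖h‖ ≤ ‖fderiv ℝ Γ y h‖)
    {s : Set U} (hs : MeasurableSet s) :
    (μHE[finrank ℝ U] : Measure V) (Γ '' s) =
      ∫⁻ y in s, ENNReal.ofReal (fderiv ℝ Γ y).toLinearMap.normDet := by
  set J : U → ℝ := fun y => (fderiv ℝ Γ y).toLinearMap.normDet with hJ
  have hJc : Continuous J := continuous_normDet (hΓ.continuous_fderiv one_ne_zero)
  have hJm : Measurable fun y => ENNReal.ofReal (J y) := hJc.measurable.ennreal_ofReal
  have hJpos : ∀ y, 0 < J y := by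
    intro y
    refine lt_of_le_of_ne (LinearMap.normDet_nonneg _) (Ne.symm ?_)
    rw [hJ, Ne, LinearMap.normDet_eq_zero_iff_ker_ne_bot, not_not, LinearMap.ker_eq_bot']
    intro h hh
    have := himm y h
    rw [ContinuousLinearMap.coe_coe] at hh
    rw [hh, norm_zero] at this
    exact norm_le_zero_iff.1 this
  have hemb : MeasurableEmbedding Γ := hΓ.continuous.measurableEmbedding hinj
  set d := finrank ℝ U
  set m : Measure U := (μHE[d] : Measure V).comap Γ
  set ρ : Measure U := volume.withDensity fun y => ENNReal.ofReal (J y)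
  have hm : ∀ t, m t = (μHE[d] : Measure V) (Γ '' t) := fun t => hemb.comap_apply _ _
  have hρ : ∀ t, MeasurableSet t → ρ t = ∫⁻ y in t, ENNReal.ofReal (J y) := fun t ht =>
    withDensity_apply _ ht
  -- Locally the pulled-back Hausdorff measure and the Jacobian density agree up to K ^ (d + 1): d
  -- factors come from the bi-Lipschitz comparison of Γ with its linearisation at y₀, and one from
  -- the oscillation of the Jacobian.
  have key : ∀ K : ℝ≥0, 1 < K → ∀ y₀, ∃ W ∈ 𝓝 y₀, ∀ t ⊆ W, MeasurableSet t →
      m t ≤ (K : ℝ≥0∞) ^ (d + 1) * ρ t ∧ ρ t ≤ (K : ℝ≥0∞) ^ (d + 1) * m t := by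
    intro K hK y₀
    have hK' : (1 : ℝ) < K := by exact_mod_cast hK
    have hK0 : (0 : ℝ) < K := by linarith
    set A := fderiv ℝ Γ y₀
    -- Chosen so that 1 - ε = 1 / K and 1 + ε ≤ K, the two Lipschitz constants needed.
    set ε : ℝ := 1 - 1 / K
    have hε : 0 < ε := by
      have : 1 / (K : ℝ) < 1 := by rw [div_lt_one hK0]; exact hK'
      simp only [ε]; linarith
    have hstrict : HasStrictFDerivAt Γ A y₀ :=
      hΓ.contDiffAt.hasStrictFDerivAt one_ne_zero
    have hlip : ∀ᶠ q : U × U in 𝓝 (y₀, y₀),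
        ‖Γ q.1 - Γ q.2 - A (q.1 - q.2)‖ ≤ ε * ‖q.1 - q.2‖ :=
      (hasStrictFDerivAt_iff_isLittleO.1 hstrict).bound hε
    rw [nhds_prod_eq] at hlip
    obtain ⟨W₁, hW₁, hlip⟩ := (eventually_prod_self_iff
      (r := fun a b => ‖Γ a - Γ b - A (a - b)‖ ≤ ε * ‖a - b‖)).1 hlip
    have hJ₁ : ∀ᶠ y in 𝓝 y₀, J y < K * J y₀ :=
      hJc.continuousAt.eventually_lt continuousAt_const
        (by nlinarith [hJpos y₀])
    have hJ₂ : ∀ᶠ y in 𝓝 y₀, J y₀ < K * J y :=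
      continuousAt_const.eventually_lt (hJc.continuousAt.const_mul (K : ℝ) |>.congr
        (Eventually.of_forall fun _ => rfl)) (by nlinarith [hJpos y₀])
    refine ⟨W₁ ∩ ({y | J y < K * J y₀} ∩ {y | J y₀ < K * J y}),
      inter_mem hW₁ (inter_mem hJ₁ hJ₂), fun t ht htm => ?_⟩
    -- The expansion hypothesis `himm` makes the linearisation error small relative to A (x - y)
    -- itself.
    have hl : ∀ x ∈ t, ∀ y ∈ t, ‖Γ x - Γ y - A (x - y)‖ ≤ ε * ‖A (x - y)‖ := fun x hx y hy =>
      (hlip x (ht hx).1 y (ht hy).1).trans (by gcongr; exact himm y₀ _)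
    have hcast : ∀ a b : V, ∀ a' b' : V, ‖a - b‖ ≤ K * ‖a' - b'‖ →
        edist a b ≤ K * edist a' b' := by
      intro a b a' b' h
      rw [edist_dist, edist_dist, dist_eq_norm, dist_eq_norm]
      calc ENNReal.ofReal ‖a - b‖ ≤ ENNReal.ofReal (K * ‖a' - b'‖) := ENNReal.ofReal_le_ofReal h
        _ = _ := by rw [ENNReal.ofReal_mul K.coe_nonneg, ENNReal.ofReal_coe_nnreal]
    have hAm : (μHE[d] : Measure V) (A '' t) = ENNReal.ofReal (J y₀) * volume t :=
      A.toLinearMap.euclideanHausdorffMeasure_image_eq_normDet_mul_volume t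
    have h1 : m t ≤ (K : ℝ≥0∞) ^ d * (ENNReal.ofReal (J y₀) * volume t) := by
      rw [hm, ← hAm]
      refine euclideanHausdorffMeasure_image_le_of_edist_le d fun x hx y hy => hcast _ _ _ _ ?_
      have h2 := hl x hx y hy
      have h3 : ‖Γ x - Γ y‖ ≤ ‖Γ x - Γ y - A (x - y)‖ + ‖A (x - y)‖ := by
        simpa using norm_add_le (Γ x - Γ y - A (x - y)) (A (x - y))
      rw [← map_sub]
      have h4 : 1 + ε ≤ K := by
        have : 0 ≤ ((K : ℝ) - 1) ^ 2 / K := by positivity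
        have e : ((K : ℝ) - 1) ^ 2 / K = K - 2 + 1 / K := by field_simp; ring
        simp only [ε]; linarith
      nlinarith [norm_nonneg (A (x - y))]
    have h2 : ENNReal.ofReal (J y₀) * volume t ≤ (K : ℝ≥0∞) ^ d * m t := by
      rw [hm, ← hAm]
      refine euclideanHausdorffMeasure_image_le_of_edist_le d fun x hx y hy => hcast _ _ _ _ ?_
      have h2 := hl x hx y hy
      have h3 : ‖A (x - y)‖ ≤ ‖Γ x - Γ y‖ + ‖Γ x - Γ y - A (x - y)‖ := by
        simpa using norm_sub_le (Γ x - Γ y) (Γ x - Γ y - A (x - y))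
      rw [← map_sub]
      have h4 : K * (1 - ε) = 1 := by simp only [ε]; field_simp; ring
      have h5 : (1 - ε) * ‖A (x - y)‖ ≤ ‖Γ x - Γ y‖ := by linarith
      calc ‖A (x - y)‖ = K * ((1 - ε) * ‖A (x - y)‖) := by rw [← mul_assoc, h4, one_mul]
        _ ≤ _ := by gcongr
    have h3 : ENNReal.ofReal (J y₀) * volume t ≤ K * ρ t := by
      rw [hρ t htm, ← lintegral_const_mul _ hJm, ← setLIntegral_const]
      refine setLIntegral_mono (hJm.const_mul _) fun y hy => ?_
      rw [← ENNReal.ofReal_coe_nnreal, ← ENNReal.ofReal_mul K.coe_nonneg]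
      exact ENNReal.ofReal_le_ofReal (ht hy).2.2.le
    have h4 : ρ t ≤ K * (ENNReal.ofReal (J y₀) * volume t) := by
      rw [hρ t htm, ← mul_assoc, ← setLIntegral_const]
      refine setLIntegral_mono measurable_const fun y hy => ?_
      rw [← ENNReal.ofReal_coe_nnreal, ← ENNReal.ofReal_mul K.coe_nonneg]
      exact ENNReal.ofReal_le_ofReal (ht hy).2.1.le
    constructor
    · calc m t ≤ (K : ℝ≥0∞) ^ d * (ENNReal.ofReal (J y₀) * volume t) := h1
        _ ≤ (K : ℝ≥0∞) ^ d * (K * ρ t) := by gcongr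
        _ = _ := by ring
    · calc ρ t ≤ K * (ENNReal.ofReal (J y₀) * volume t) := h4
        _ ≤ K * ((K : ℝ≥0∞) ^ d * m t) := by gcongr
        _ = _ := by ring
  -- The distortion is removed by letting K decrease to 1.
  have hlim : ∀ a b : ℝ≥0∞, (∀ K : ℝ≥0, 1 < K → a ≤ (K : ℝ≥0∞) ^ (d + 1) * b) → a ≤ b := by
    intro a b h
    rcases eq_or_ne b ∞ with rfl | hb
    · exact le_top
    have ht : Tendsto (fun K : ℝ≥0 => (K : ℝ≥0∞) ^ (d + 1) * b) (𝓝[>] 1)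
        (𝓝 (((1 : ℝ≥0) : ℝ≥0∞) ^ (d + 1) * b)) := by
      refine ENNReal.Tendsto.mul_const ?_ (Or.inr hb)
      have : Continuous fun K : ℝ≥0 => (K : ℝ≥0∞) ^ (d + 1) :=
        (ENNReal.continuous_pow _).comp ENNReal.continuous_coe
      exact (this.tendsto 1).mono_left nhdsWithin_le_nhds
    simp only [ENNReal.coe_one, one_pow, one_mul] at ht
    exact ge_of_tendsto ht (eventually_mem_nhdsWithin.mono fun K hK => h K hK)
  have hsm : ∀ (c : ℝ≥0∞) (μ : Measure U) t, (c • μ) t = c * μ t := fun c μ t => rfl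
  rw [← hm, ← hρ s hs]
  refine le_antisymm (hlim _ _ fun K hK => ?_) (hlim _ _ fun K hK => ?_)
  · rw [← hsm]
    refine measure_le_of_locally_le (fun y => ?_) s
    obtain ⟨W, hW, h⟩ := key K hK y
    exact ⟨W, hW, fun t ht htm => (h t ht htm).1⟩
  · rw [← hsm]
    refine measure_le_of_locally_le (fun y => ?_) s
    obtain ⟨W, hW, h⟩ := key K hK y
    exact ⟨W, hW, fun t ht htm => (h t ht htm).2⟩

end AreaFormula

/-! ### Boundary charts, the outward normal and the shape operator. -/

/-- The Euclidean plane. -/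
abbrev E2 : Type := EuclideanSpace ℝ (Fin 2)

/-- A presentation of `Ω` near `p` as the strict epigraph of a smooth function `γ` over the plane
`J(ℝ²)`, in the direction of the unit vector `e` orthogonal to that plane. -/
structure GraphChart (Ω : Set E3) (p : E3) where
  r : ℝ
  r_pos : 0 < r
  J : E2 →ₗᵢ[ℝ] E3
  P : E3 →L[ℝ] E2
  e : E3
  norm_e : ‖e‖ = 1
  inner_e_J : ∀ y, inner ℝ e (J y) = 0
  decomp : ∀ x, J (P x) + (inner ℝ e x : ℝ) • e = x
  γ : E2 → ℝ
  smooth : ContDiff ℝ ∞ γ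
  mem_iff : ∀ x ∈ Metric.ball p r, x ∈ Ω ↔ γ (P x) < inner ℝ e x

theorem IsSmoothBoundedDomain.nonempty_graphChart {Ω : Set E3} (hΩ : IsSmoothBoundedDomain Ω)
    {p : E3} (hp : p ∈ frontier Ω) : Nonempty (GraphChart Ω p) := by
  obtain ⟨r, hr, L, γ, hγ, h⟩ := hΩ.smooth_boundary p hp
  let J₀ : E2 →ₗ[ℝ] E3 :=
    { toFun := fun y => !₂[y 0, y 1, 0]
      map_add' := fun x y => by ext i; fin_cases i <;> simp
      map_smul' := fun c y => by ext i; fin_cases i <;> simp }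
  let J₁ : E2 →ₗᵢ[ℝ] E3 := ⟨J₀, fun y => by
    simp [J₀, EuclideanSpace.norm_eq, Fin.sum_univ_three, Fin.sum_univ_two]⟩
  let P₀ : E3 →ₗ[ℝ] E2 :=
    { toFun := fun x => !₂[L x 0, L x 1]
      map_add' := fun x y => by ext i; fin_cases i <;> simp
      map_smul' := fun c y => by ext i; fin_cases i <;> simp }
  have he : ∀ x, inner ℝ (L.symm (EuclideanSpace.single 2 (1 : ℝ))) x = L x 2 := fun x => by
    rw [← L.inner_map_map, L.apply_symm_apply, EuclideanSpace.inner_single_left]; simp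
  refine ⟨⟨r, hr, L.symm.toLinearIsometry.comp J₁, LinearMap.toContinuousLinearMap P₀,
    L.symm (EuclideanSpace.single 2 1), by simp, fun y => ?_, fun x => ?_, γ, hγ, fun x hx => ?_⟩⟩
  · rw [he]; simp [J₁, J₀]
  · rw [he]
    apply L.injective
    ext i
    fin_cases i <;> simp [J₁, J₀, P₀]
  · rw [he, h x hx]; simp [P₀]

theorem inner_sub_inner_smul_self {v n : E3} (hn : ‖n‖ = 1) :
    (inner ℝ (v - (inner ℝ v n : ℝ) • n) n : ℝ) = 0 := by
  rw [inner_sub_left, inner_smul_left, real_inner_self_eq_norm_sq, hn]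
  simp

/-- If n ≠ n', the direction n' - n makes an obtuse angle with n and an acute one with n', so short
steps along it would lie both inside and outside Ω. -/
theorem IsOutwardUnitNormal.unique {Ω : Set E3} {p n n' : E3} (h : IsOutwardUnitNormal Ω p n)
    (h' : IsOutwardUnitNormal Ω p n') : n = n' := by
  by_contra hne
  have hlt : (inner ℝ n n' : ℝ) < 1 := by
    rcases (real_inner_le_norm n n').lt_or_eq with hlt | heq
    · simpa [h.1, h'.1] using hlt
    · refine absurd ((inner_eq_one_iff_of_norm_eq_one (𝕜 := ℝ) h.1 h'.1).1 ?_) hne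
      simpa [h.1, h'.1] using heq
  have h1 : (inner ℝ (n' - n) n : ℝ) < 0 := by
    rw [inner_sub_left, real_inner_self_eq_norm_sq, h.1, real_inner_comm]; linarith
  have h2 : 0 < (inner ℝ (n' - n) n' : ℝ) := by
    rw [inner_sub_left, real_inner_self_eq_norm_sq, h'.1]; linarith
  obtain ⟨ε, h3, h4⟩ := ((h.2.1 _ h1).and (h'.2.2 _ h2)).exists
  exact h4 h3

theorem IsOutwardUnitNormal.outwardNormal_eq {Ω : Set E3} {p n : E3}
    (h : IsOutwardUnitNormal Ω p n) : outwardNormal Ω p = n := by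
  have hex : ∃ n, IsOutwardUnitNormal Ω p n := ⟨n, h⟩
  rw [outwardNormal, dif_pos hex]
  exact hex.choose_spec.unique h

namespace GraphChart

variable {Ω : Set E3} {p : E3} (c : GraphChart Ω p)

theorem P_J (y : E2) : c.P (c.J y) = y := by
  apply c.J.injective
  have := c.decomp (c.J y)
  rwa [c.inner_e_J, zero_smul, add_zero] at this

theorem inner_e_e : (inner ℝ c.e c.e : ℝ) = 1 := by
  rw [real_inner_self_eq_norm_sq, c.norm_e, one_pow]

theorem P_e : c.P c.e = 0 := by
  apply c.J.injective
  have := c.decomp c.e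
  rw [c.inner_e_e, one_smul] at this
  simpa using this

theorem inner_J (y : E2) (x : E3) : (inner ℝ (c.J y) x : ℝ) = inner ℝ y (c.P x) := by
  conv_lhs => rw [← c.decomp x]
  rw [inner_add_right, c.J.inner_map_map, inner_smul_right, real_inner_comm c.e (c.J y),
    c.inner_e_J, mul_zero, add_zero]

/-- The parametrisation of the graph. -/
def param (y : E2) : E3 := c.J y + c.γ y • c.e

/-- The defining function, negative inside `Ω`. -/
def defining (x : E3) : ℝ := c.γ (c.P x) - inner ℝ c.e x

/-- The gradient of the defining function. -/
def grad (x : E3) : E3 := c.J (gradient c.γ (c.P x)) - c.e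

theorem P_param (y : E2) : c.P (c.param y) = y := by
  rw [param, map_add, map_smul, c.P_J, c.P_e, smul_zero, add_zero]

theorem inner_e_param (y : E2) : (inner ℝ c.e (c.param y) : ℝ) = c.γ y := by
  rw [param, inner_add_right, c.inner_e_J, inner_smul_right, c.inner_e_e, mul_one, zero_add]

theorem defining_param (y : E2) : c.defining (c.param y) = 0 := by
  rw [defining, P_param, inner_e_param, sub_self]

theorem param_injective : Function.Injective c.param :=
  Function.LeftInverse.injective (g := c.P) c.P_param

theorem param_P {x : E3} (hx : c.defining x = 0) : c.param (c.P x) = x := by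
  rw [param, sub_eq_zero.1 hx, c.decomp]

theorem contDiff_param : ContDiff ℝ ∞ c.param := by
  have := c.smooth
  have h : ContDiff ℝ ∞ c.J := c.J.toContinuousLinearMap.contDiff
  unfold param
  fun_prop

theorem contDiff_defining : ContDiff ℝ ∞ c.defining :=
  (c.smooth.comp c.P.contDiff).sub (contDiff_const.inner ℝ contDiff_id)

theorem contDiff_gradient : ContDiff ℝ ∞ (gradient c.γ) := by
  have h : ContDiff ℝ ∞ (fderiv ℝ c.γ) := c.smooth.fderiv_right (m := ∞) (by simp)
  exact (InnerProductSpace.toDual ℝ E2).symm.toContinuousLinearEquiv.contDiff.comp h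

theorem contDiff_grad : ContDiff ℝ ∞ c.grad :=
  (c.J.toContinuousLinearMap.contDiff.comp (c.contDiff_gradient.comp c.P.contDiff)).sub
    contDiff_const

theorem fderiv_γ (y h : E2) : fderiv ℝ c.γ y h = inner ℝ (gradient c.γ y) h := by
  rw [gradient, InnerProductSpace.toDual_symm_apply]

theorem inner_grad (x v : E3) :
    (inner ℝ (c.grad x) v : ℝ) = fderiv ℝ c.γ (c.P x) (c.P v) - inner ℝ c.e v := by
  rw [grad, inner_sub_left, c.inner_J, fderiv_γ]

theorem hasFDerivAt_defining (x : E3) :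
    HasFDerivAt c.defining (innerSL ℝ (c.grad x)) x := by
  have h1 : HasFDerivAt (fun x => c.γ (c.P x)) ((fderiv ℝ c.γ (c.P x)).comp c.P) x :=
    ((c.smooth.differentiable (by simp)).differentiableAt.hasFDerivAt).comp x c.P.hasFDerivAt
  have h2 : HasFDerivAt (fun x => (inner ℝ c.e x : ℝ)) (innerSL ℝ c.e) x :=
    (innerSL ℝ c.e).hasFDerivAt
  refine (h1.sub h2).congr_fderiv ?_
  ext v
  simp [c.inner_grad]

theorem norm_grad_sq (x : E3) : ‖c.grad x‖ ^ 2 = ‖gradient c.γ (c.P x)‖ ^ 2 + 1 := by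
  rw [grad, norm_sub_sq_real, c.J.norm_map, c.norm_e, real_inner_comm, c.inner_e_J]
  ring

theorem norm_grad_pos (x : E3) : 0 < ‖c.grad x‖ := by
  have := c.norm_grad_sq x
  refine lt_of_le_of_ne (norm_nonneg _) fun h => ?_
  rw [← h] at this
  nlinarith [sq_nonneg ‖gradient c.γ (c.P x)‖]

theorem mem_iff_defining {x : E3} (hx : x ∈ Metric.ball p c.r) : x ∈ Ω ↔ c.defining x < 0 := by
  rw [c.mem_iff x hx, defining, sub_neg]

theorem eventually_line {x : E3} (hx : x ∈ Metric.ball p c.r) (v : E3) :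
    ∀ᶠ ε : ℝ in 𝓝[>] 0, x + ε • v ∈ Metric.ball p c.r := by
  have hc : Continuous fun ε : ℝ => x + ε • v := by fun_prop
  refine (hc.tendsto 0).mono_left nhdsWithin_le_nhds ?_
  simpa using Metric.isOpen_ball.mem_nhds hx

theorem hasDerivAt_line (x v : E3) :
    HasDerivAt (fun ε : ℝ => c.defining (x + ε • v)) (inner ℝ (c.grad x) v) 0 := by
  have h1 : HasDerivAt (fun ε : ℝ => x + ε • v) v 0 := by
    simpa using ((hasDerivAt_id (0 : ℝ)).smul_const v).const_add x
  have h2 : HasFDerivAt c.defining (innerSL ℝ (c.grad x)) (x + (0 : ℝ) • v) := by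
    simpa using c.hasFDerivAt_defining x
  have h3 := h2.comp_hasDerivAt (0 : ℝ) h1
  rwa [innerSL_apply_apply] at h3

theorem eventually_defining_neg {x v : E3} (h0 : c.defining x = 0)
    (hv : (inner ℝ (c.grad x) v : ℝ) < 0) : ∀ᶠ ε : ℝ in 𝓝[>] 0, c.defining (x + ε • v) < 0 := by
  have h := (hasDerivAt_iff_tendsto_slope_zero.1 (c.hasDerivAt_line x v)).mono_left
    (nhdsWithin_mono _ (fun ε (hε : 0 < ε) => hε.ne'))
  filter_upwards [h.eventually_lt_const hv, self_mem_nhdsWithin] with ε h1 (hε : 0 < ε)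
  simp only [zero_add, zero_smul, add_zero, h0, sub_zero, smul_eq_mul] at h1
  by_contra hge
  exact absurd h1 (not_lt.2 (mul_nonneg (inv_nonneg.2 hε.le) (not_lt.1 hge)))

theorem eventually_defining_pos {x v : E3} (h0 : c.defining x = 0)
    (hv : 0 < (inner ℝ (c.grad x) v : ℝ)) : ∀ᶠ ε : ℝ in 𝓝[>] 0, 0 < c.defining (x + ε • v) := by
  have h := (hasDerivAt_iff_tendsto_slope_zero.1 (c.hasDerivAt_line x v)).mono_left
    (nhdsWithin_mono _ (fun ε (hε : 0 < ε) => hε.ne'))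
  filter_upwards [h.eventually_const_lt hv, self_mem_nhdsWithin] with ε h1 (hε : 0 < ε)
  simp only [zero_add, zero_smul, add_zero, h0, sub_zero, smul_eq_mul] at h1
  by_contra hge
  exact absurd h1 (not_lt.2 (mul_nonpos_of_nonneg_of_nonpos (inv_nonneg.2 hε.le) (not_lt.1 hge)))

/-- The gradient of the defining function never vanishes, so from any of its zeros a short step
along minus the gradient enters Ω. Conversely, a point where the function is positive has a
neighbourhood disjoint from Ω. -/
theorem mem_frontier_iff (hΩ : IsOpen Ω) {x : E3} (hx : x ∈ Metric.ball p c.r) :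
    x ∈ frontier Ω ↔ c.defining x = 0 := by
  rw [hΩ.frontier_eq]
  constructor
  · rintro ⟨h1, h2⟩
    rw [c.mem_iff_defining hx, not_lt] at h2
    refine le_antisymm (not_lt.1 fun h3 => ?_) h2
    have : {y | 0 < c.defining y} ∩ Metric.ball p c.r ∈ 𝓝 x :=
      inter_mem ((isOpen_lt continuous_const c.contDiff_defining.continuous).mem_nhds h3)
        (Metric.isOpen_ball.mem_nhds hx)
    obtain ⟨y, ⟨hy1, hy2⟩, hy3⟩ := mem_closure_iff_nhds.1 h1 _ this
    exact absurd ((c.mem_iff_defining hy2).1 hy3) (not_lt.2 (le_of_lt hy1))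
  · intro h0
    refine ⟨?_, fun h => absurd ((c.mem_iff_defining hx).1 h) (by rw [h0]; exact lt_irrefl _)⟩
    have hv : (inner ℝ (c.grad x) (-c.grad x) : ℝ) < 0 := by
      rw [inner_neg_right, real_inner_self_eq_norm_sq]
      have := c.norm_grad_pos x
      nlinarith
    have hc : Tendsto (fun ε : ℝ => x + ε • (-c.grad x)) (𝓝[>] 0) (𝓝 x) := by
      have hc : Continuous fun ε : ℝ => x + ε • (-c.grad x) := by fun_prop
      have := (hc.tendsto 0).mono_left (nhdsWithin_le_nhds (s := Set.Ioi 0))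
      simpa using this
    refine mem_closure_of_tendsto hc ?_
    filter_upwards [c.eventually_defining_neg h0 hv, c.eventually_line hx (-c.grad x)] with ε h1 h2
    exact (c.mem_iff_defining h2).2 h1

/-- The outward unit normal, extended off the boundary. -/
def normal (x : E3) : E3 := ‖c.grad x‖⁻¹ • c.grad x

theorem contDiff_normal : ContDiff ℝ ∞ c.normal :=
  ((c.contDiff_grad.norm ℝ fun x => norm_pos_iff.1 (c.norm_grad_pos x)).inv
    fun x => (c.norm_grad_pos x).ne').smul c.contDiff_grad

theorem norm_normal (x : E3) : ‖c.normal x‖ = 1 := by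
  rw [normal, norm_smul, norm_inv, norm_norm, inv_mul_cancel₀ (c.norm_grad_pos x).ne']

/-- Along a line from a boundary point, the defining function has slope ⟨grad, v⟩ at 0. Its sign
decides on which side short steps land. -/
theorem outwardNormal_eq (hΩ : IsOpen Ω) {x : E3} (hx : x ∈ Metric.ball p c.r)
    (hf : x ∈ frontier Ω) : outwardNormal Ω x = c.normal x := by
  have h0 := (c.mem_frontier_iff hΩ hx).1 hf
  have hinner : ∀ v, (inner ℝ v (c.normal x) : ℝ) = ‖c.grad x‖⁻¹ * inner ℝ (c.grad x) v := by
    intro v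
    rw [normal, inner_smul_right, real_inner_comm]
  have hpos : 0 < ‖c.grad x‖⁻¹ := inv_pos.2 (c.norm_grad_pos x)
  refine IsOutwardUnitNormal.outwardNormal_eq ⟨c.norm_normal x, fun v hv => ?_, fun v hv => ?_⟩
  · rw [hinner] at hv
    have hv' : (inner ℝ (c.grad x) v : ℝ) < 0 := by
      by_contra h
      exact absurd hv (not_lt.2 (mul_nonneg hpos.le (not_lt.1 h)))
    filter_upwards [c.eventually_defining_neg h0 hv', c.eventually_line hx v] with ε h1 h2
    exact (c.mem_iff_defining h2).2 h1
  · rw [hinner] at hv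
    have hv' : 0 < (inner ℝ (c.grad x) v : ℝ) := pos_of_mul_pos_right hv hpos.le
    filter_upwards [c.eventually_defining_pos h0 hv', c.eventually_line hx v] with ε h1 h2 h3
    exact absurd ((c.mem_iff_defining h2).1 h3) (not_lt.2 h1.le)

theorem hasFDerivAt_param (y : E2) :
    HasFDerivAt c.param (c.J.toContinuousLinearMap + (fderiv ℝ c.γ y).smulRight c.e) y :=
  c.J.toContinuousLinearMap.hasFDerivAt.add
    (((c.smooth.differentiable (by simp)).differentiableAt.hasFDerivAt).smul_const c.e)

theorem fderiv_param_apply (y h : E2) :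
    fderiv ℝ c.param y h = c.J h + fderiv ℝ c.γ y h • c.e := by
  rw [(c.hasFDerivAt_param y).fderiv]; simp

theorem inner_fderiv_param (y h k : E2) :
    (inner ℝ (fderiv ℝ c.param y h) (fderiv ℝ c.param y k) : ℝ) =
      inner ℝ h k + fderiv ℝ c.γ y h * fderiv ℝ c.γ y k := by
  have hJe : ∀ y, (inner ℝ (c.J y) c.e : ℝ) = 0 := fun y => by
    rw [real_inner_comm, c.inner_e_J]
  simp only [fderiv_param_apply, inner_add_left, inner_add_right, inner_smul_left,
    inner_smul_right, c.J.inner_map_map, c.inner_e_J, c.inner_e_e, hJe]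
  simp
  ring

/-- The Gram matrix of the parametrisation is I + ∇γ ∇γᵗ, with determinant 1 + |∇γ|², which is also
the squared norm of the gradient of the defining function. -/
theorem normDet_fderiv_param (y : E2) :
    (fderiv ℝ c.param y).toLinearMap.normDet = ‖c.grad (c.param y)‖ := by
  have h1 := (fderiv ℝ c.param y).toLinearMap.normDet_sq_eq_det_gram
    (EuclideanSpace.basisFun (Fin 2) ℝ)
  have h2 := c.norm_grad_sq (c.param y)
  rw [c.P_param, EuclideanSpace.norm_sq_eq (gradient c.γ y), Fin.sum_univ_two] at h2
  have h3 : ∀ i, gradient c.γ y i = fderiv ℝ c.γ y (EuclideanSpace.single i 1) := fun i => by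
    rw [fderiv_γ, EuclideanSpace.inner_single_right]; simp
  rw [← sq_eq_sq₀ (LinearMap.normDet_nonneg _) (norm_nonneg _), h2, h3, h3]
  rw [Matrix.det_fin_two] at h1
  simp only [Matrix.gram_apply, ContinuousLinearMap.coe_coe, inner_fderiv_param,
    EuclideanSpace.basisFun_apply, EuclideanSpace.inner_single_left] at h1
  simp at h1
  rw [h1]
  simp only [Real.norm_eq_abs, sq_abs]
  ring

/-- This is the area formula for the graph, localised to the ball because only there is the boundary
known to coincide with the graph. -/
theorem surfaceMeasure_restrict_ball (hΩ : IsOpen Ω) :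
    (surfaceMeasure Ω).restrict (Metric.ball p c.r) =
      ((volume.withDensity fun y => ENNReal.ofReal ‖c.grad (c.param y)‖).map c.param).restrict
        (Metric.ball p c.r) := by
  have hcont := c.contDiff_param.continuous
  have hemb : MeasurableEmbedding c.param := hcont.measurableEmbedding c.param_injective
  ext s hs
  have hsB : MeasurableSet (s ∩ Metric.ball p c.r) := hs.inter Metric.isOpen_ball.measurableSet
  rw [Measure.restrict_apply hs, Measure.restrict_apply hs, surfaceMeasure,
    Measure.restrict_apply hsB, Measure.map_apply hcont.measurable hsB,
    withDensity_apply _ (hcont.measurable hsB)]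
  have himg : s ∩ Metric.ball p c.r ∩ frontier Ω =
      c.param '' (c.param ⁻¹' (s ∩ Metric.ball p c.r)) := by
    ext x
    constructor
    · rintro ⟨hx, hf⟩
      have h0 := c.param_P ((c.mem_frontier_iff hΩ hx.2).1 hf)
      exact ⟨c.P x, by rwa [Set.mem_preimage, h0], h0⟩
    · rintro ⟨y, hy, rfl⟩
      exact ⟨hy, (c.mem_frontier_iff hΩ hy.2).2 (c.defining_param y)⟩
  have hdim : Module.finrank ℝ E2 = 2 := by simp
  have harea := euclideanHausdorffMeasure_image_eq_lintegral
    (c.contDiff_param.of_le (by simp)) c.param_injective (fun y h => ?_) (hcont.measurable hsB)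
  · rw [hdim] at harea
    rw [himg, harea]
    simp only [c.normDet_fderiv_param]
  · rw [← sq_le_sq₀ (norm_nonneg _) (norm_nonneg _), ← real_inner_self_eq_norm_sq (fderiv _ _ _ _),
      inner_fderiv_param, real_inner_self_eq_norm_sq]
    nlinarith [sq_nonneg (fderiv ℝ c.γ y h)]

theorem mem_ball_self : p ∈ Metric.ball p c.r := Metric.mem_ball_self c.r_pos

/-- A curve on the graph through `p`, with velocity `v` if `v` is tangent to the graph. -/
def curve (v : E3) (s : ℝ) : E3 := c.param (c.P p + s • c.P v)

theorem hasDerivAt_curve {v : E3} (hv : (inner ℝ (c.grad p) v : ℝ) = 0) :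
    HasDerivAt (c.curve v) v 0 := by
  have h1 : HasDerivAt (fun s : ℝ => c.P p + s • c.P v) (c.P v) 0 := by
    simpa using ((hasDerivAt_id (0 : ℝ)).smul_const (c.P v)).const_add (c.P p)
  have h2 := (c.hasFDerivAt_param (c.P p + (0 : ℝ) • c.P v)).comp_hasDerivAt (0 : ℝ) h1
  refine h2.congr_deriv ?_
  rw [c.inner_grad, sub_eq_zero] at hv
  simp [hv, c.decomp]

theorem curve_zero (hΩ : IsOpen Ω) (hp : p ∈ frontier Ω) (v : E3) : c.curve v 0 = p := by
  rw [curve, zero_smul, add_zero, c.param_P ((c.mem_frontier_iff hΩ c.mem_ball_self).1 hp)]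

theorem eventually_curve_mem (hΩ : IsOpen Ω) (hp : p ∈ frontier Ω) (v : E3) :
    ∀ᶠ s in 𝓝 (0 : ℝ), c.curve v s ∈ Metric.ball p c.r ∧ c.curve v s ∈ frontier Ω := by
  have hc : Continuous (c.curve v) := by
    have := c.contDiff_param.continuous
    unfold curve
    fun_prop
  have : ∀ᶠ s in 𝓝 (0 : ℝ), c.curve v s ∈ Metric.ball p c.r := by
    refine hc.continuousAt.eventually_mem (Metric.isOpen_ball.mem_nhds ?_)
    rw [c.curve_zero hΩ hp]
    exact c.mem_ball_self
  filter_upwards [this] with s hs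
  exact ⟨hs, (c.mem_frontier_iff hΩ hs).2 (c.defining_param _)⟩

theorem inner_grad_eq (hΩ : IsOpen Ω) (hp : p ∈ frontier Ω) (v : E3) :
    (inner ℝ (c.grad p) v : ℝ) = ‖c.grad p‖ * inner ℝ v (outwardNormal Ω p) := by
  rw [c.outwardNormal_eq hΩ c.mem_ball_self hp, normal, inner_smul_right, ← mul_assoc,
    mul_inv_cancel₀ (c.norm_grad_pos p).ne', one_mul, real_inner_comm]

theorem differentiableAt_normal (x : E3) : DifferentiableAt ℝ c.normal x :=
  (c.contDiff_normal.differentiable (by simp)).differentiableAt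

/-- The derivative within the boundary is not unique as a linear map on the ambient space, but the
projected vector is tangent, and there it agrees with the derivative of the smooth extension of the
normal. -/
theorem shapeOperator_eq (hΩ : IsOpen Ω) (hp : p ∈ frontier Ω) (v : E3) :
    shapeOperator Ω p v = fderiv ℝ c.normal p
      (v - (inner ℝ v (outwardNormal Ω p) : ℝ) • outwardNormal Ω p) := by
  set a := v - (inner ℝ v (outwardNormal Ω p) : ℝ) • outwardNormal Ω p with ha
  have h0 : (inner ℝ (c.grad p) a : ℝ) = 0 := by
    rw [c.inner_grad_eq hΩ hp, inner_sub_inner_smul_self, mul_zero]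
    rw [c.outwardNormal_eq hΩ c.mem_ball_self hp, c.norm_normal]
  have h1 : HasFDerivWithinAt (outwardNormal Ω) (fderiv ℝ c.normal p) (frontier Ω) p := by
    refine (c.differentiableAt_normal p).hasFDerivAt.hasFDerivWithinAt.congr_of_eventuallyEq ?_
      (c.outwardNormal_eq hΩ c.mem_ball_self hp)
    filter_upwards [mem_nhdsWithin_of_mem_nhds (Metric.isOpen_ball.mem_nhds c.mem_ball_self),
      self_mem_nhdsWithin] with x hx hf
    exact c.outwardNormal_eq hΩ hx hf
  have h2 := h1.differentiableWithinAt.hasFDerivWithinAt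
  have hz := c.curve_zero hΩ hp a
  -- Any derivative within the boundary, applied to the tangent vector a, is the velocity of the
  -- normal along a boundary curve with velocity a.
  have key : ∀ A : E3 →L[ℝ] E3, HasFDerivWithinAt (outwardNormal Ω) A (frontier Ω) p →
      HasDerivAt (outwardNormal Ω ∘ c.curve a) (A a) 0 := by
    intro A hA
    rw [← hz] at hA
    exact hA.comp_hasDerivAt 0 (c.hasDerivAt_curve h0)
      ((c.eventually_curve_mem hΩ hp a).mono fun s hs => hs.2)
  exact (key _ h2).unique (key _ h1)

/-- The derivative of the normal is the Hessian of the defining function divided by ‖grad‖, plus a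
multiple of the gradient. The Hessian is symmetric, and the multiple is orthogonal to tangent
vectors. -/
theorem inner_fderiv_normal_symm {a b : E3} (ha : (inner ℝ (c.grad p) a : ℝ) = 0)
    (hb : (inner ℝ (c.grad p) b : ℝ) = 0) :
    (inner ℝ (fderiv ℝ c.normal p a) b : ℝ) = inner ℝ (fderiv ℝ c.normal p b) a := by
  have hd : DifferentiableAt ℝ c.grad p :=
    (c.contDiff_grad.differentiable (by simp)).differentiableAt
  have hi : DifferentiableAt ℝ (fun x => ‖c.grad x‖⁻¹) p :=
    (hd.norm ℝ (norm_pos_iff.1 (c.norm_grad_pos p))).inv (c.norm_grad_pos p).ne'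
  have h1 : ∀ v, fderiv ℝ c.normal p v =
      ‖c.grad p‖⁻¹ • fderiv ℝ c.grad p v +
        fderiv ℝ (fun x => ‖c.grad x‖⁻¹) p v • c.grad p := by
    intro v
    have : c.normal = fun x => ‖c.grad x‖⁻¹ • c.grad x := rfl
    rw [this, fderiv_fun_smul hi hd]
    simp
  have h2 : fderiv ℝ c.defining = fun x => innerSL ℝ (c.grad x) :=
    funext fun x => (c.hasFDerivAt_defining x).fderiv
  have h3 : ∀ u v, fderiv ℝ (fderiv ℝ c.defining) p u v = inner ℝ (fderiv ℝ c.grad p u) v := by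
    intro u v
    have := ((innerSL ℝ).hasFDerivAt (x := c.grad p)).comp p hd.hasFDerivAt
    rw [h2]
    rw [show (fun x => innerSL ℝ (c.grad x)) = innerSL ℝ ∘ c.grad from rfl,
      HasFDerivAt.fderiv this]
    rfl
  have h4 : fderiv ℝ (fderiv ℝ c.defining) p a b = fderiv ℝ (fderiv ℝ c.defining) p b a :=
    (c.contDiff_defining.contDiffAt.isSymmSndFDerivAt
      (by simpa using WithTop.coe_le_coe.2 (OrderTop.le_top (2 : ℕ∞)))) a b
  rw [h1, h1, inner_add_left, inner_add_left, inner_smul_left, inner_smul_left, inner_smul_left,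
    inner_smul_left, ha, hb, ← h3, ← h3, h4, mul_zero, mul_zero]

/-- Differentiate w · 𝐧 = 0 along a boundary curve through p with velocity a. -/
theorem inner_fderiv_normal_of_tangent (hΩ : IsOpen Ω) (hp : p ∈ frontier Ω) {w : E3 → E3}
    {A : E3 →L[ℝ] E3} (hw : HasFDerivAt w A p)
    (ht : ∀ x ∈ frontier Ω, (inner ℝ (w x) (outwardNormal Ω x) : ℝ) = 0)
    {a : E3} (ha : (inner ℝ (c.grad p) a : ℝ) = 0) :
    (inner ℝ (w p) (fderiv ℝ c.normal p a) : ℝ) = -inner ℝ (A a) (outwardNormal Ω p) := by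
  have hz := c.curve_zero hΩ hp a
  have h1 : HasDerivAt (fun s => w (c.curve a s)) (A a) 0 := by
    rw [← hz] at hw
    exact hw.comp_hasDerivAt 0 (c.hasDerivAt_curve ha)
  have h2 : HasDerivAt (fun s => c.normal (c.curve a s)) (fderiv ℝ c.normal p a) 0 := by
    have := (c.differentiableAt_normal (c.curve a 0)).hasFDerivAt.comp_hasDerivAt 0
      (c.hasDerivAt_curve ha)
    rwa [hz] at this
  have h3 := h1.inner ℝ h2
  have h4 : (fun s => (inner ℝ (w (c.curve a s)) (c.normal (c.curve a s)) : ℝ)) =ᶠ[𝓝 0]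
      fun _ => 0 := by
    filter_upwards [c.eventually_curve_mem hΩ hp a] with s hs
    rw [← c.outwardNormal_eq hΩ hs.1 hs.2, ht _ hs.2]
  have h5 := h3.unique ((hasDerivAt_const (0 : ℝ) (0 : ℝ)).congr_of_eventuallyEq h4)
  rw [hz] at h5
  rw [c.outwardNormal_eq hΩ c.mem_ball_self hp]
  linarith

end GraphChart

theorem IsSmoothBoundedDomain.norm_outwardNormal {Ω : Set E3} (hΩ : IsSmoothBoundedDomain Ω)
    {p : E3} (hp : p ∈ frontier Ω) : ‖outwardNormal Ω p‖ = 1 := by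
  obtain ⟨c⟩ := hΩ.nonempty_graphChart hp
  rw [c.outwardNormal_eq hΩ.isOpen c.mem_ball_self hp, c.norm_normal]

theorem IsSmoothBoundedDomain.continuousOn_outwardNormal {Ω : Set E3}
    (hΩ : IsSmoothBoundedDomain Ω) : ContinuousOn (outwardNormal Ω) (frontier Ω) := by
  intro p hp
  obtain ⟨c⟩ := hΩ.nonempty_graphChart hp
  refine c.contDiff_normal.continuous.continuousWithinAt.congr_of_eventuallyEq ?_
    (c.outwardNormal_eq hΩ.isOpen c.mem_ball_self hp)
  filter_upwards [mem_nhdsWithin_of_mem_nhds (Metric.isOpen_ball.mem_nhds c.mem_ball_self),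
    self_mem_nhdsWithin] with x hx hf
  exact c.outwardNormal_eq hΩ.isOpen hx hf

/-- The shape operator pairs a tangent field `w` with `v` through the derivative of `w`. -/
theorem IsSmoothBoundedDomain.inner_shapeOperator_of_tangent {Ω : Set E3}
    (hΩ : IsSmoothBoundedDomain Ω) {p : E3} (hp : p ∈ frontier Ω) {w : E3 → E3}
    {A : E3 →L[ℝ] E3} (hw : HasFDerivAt w A p)
    (ht : ∀ x ∈ frontier Ω, (inner ℝ (w x) (outwardNormal Ω x) : ℝ) = 0) (v : E3) :
    (inner ℝ (w p) (shapeOperator Ω p v) : ℝ) =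
      -inner ℝ (A (v - (inner ℝ v (outwardNormal Ω p) : ℝ) • outwardNormal Ω p))
        (outwardNormal Ω p) := by
  obtain ⟨c⟩ := hΩ.nonempty_graphChart hp
  rw [c.shapeOperator_eq hΩ.isOpen hp, c.inner_fderiv_normal_of_tangent hΩ.isOpen hp hw ht]
  rw [c.inner_grad_eq hΩ.isOpen hp, inner_sub_inner_smul_self (hΩ.norm_outwardNormal hp), mul_zero]

/-- The shape operator is symmetric on tangent vectors. -/
theorem IsSmoothBoundedDomain.inner_shapeOperator_symm {Ω : Set E3}
    (hΩ : IsSmoothBoundedDomain Ω) {p : E3} (hp : p ∈ frontier Ω) {a b : E3}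
    (ha : (inner ℝ a (outwardNormal Ω p) : ℝ) = 0) (hb : (inner ℝ b (outwardNormal Ω p) : ℝ) = 0) :
    (inner ℝ a (shapeOperator Ω p b) : ℝ) = inner ℝ b (shapeOperator Ω p a) := by
  obtain ⟨c⟩ := hΩ.nonempty_graphChart hp
  rw [c.shapeOperator_eq hΩ.isOpen hp, c.shapeOperator_eq hΩ.isOpen hp, ha, hb, zero_smul,
    sub_zero, sub_zero, real_inner_comm, c.inner_fderiv_normal_symm, real_inner_comm]
  · rw [c.inner_grad_eq hΩ.isOpen hp, hb, mul_zero]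
  · rw [c.inner_grad_eq hΩ.isOpen hp, ha, mul_zero]

/-! ### The divergence theorem. -/

theorem integral_fderiv_apply_eq_zero {E : Type*} [NormedAddCommGroup E] [NormedSpace ℝ E]
    [FiniteDimensional ℝ E] [MeasurableSpace E] [BorelSpace E] {μ : Measure E}
    [μ.IsAddHaarMeasure] {f : E → ℝ} (hf : ContDiff ℝ 1 f) (hc : HasCompactSupport f) (v : E) :
    ∫ x, fderiv ℝ f x v ∂μ = 0 := by
  have h1 : Integrable (fun x => fderiv ℝ f x v) μ :=
    ((hf.continuous_fderiv one_ne_zero).clm_apply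
      continuous_const).integrable_of_hasCompactSupport (hc.fderiv_apply ℝ v)
  have h := integral_mul_fderiv_eq_neg_fderiv_mul_of_integrable (μ := μ) (f := fun _ : E => (1 : ℝ))
    (g := f) (v := v) (by simp) (by simpa using h1)
    (by simpa using hf.continuous.integrable_of_hasCompactSupport hc)
    (fun x _ => differentiableAt_const _) (fun x _ => hf.differentiable one_ne_zero x)
  simpa using h

namespace GraphChart

variable {Ω : Set E3} {p : E3} (c : GraphChart Ω p)

/-- Coordinates straightening the graph: `(y, s)` is sent to the point of height `s` above the point
of the graph with base point `y`. -/
def straighten : E2 × ℝ ≃ₜ E3 where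
  toFun q := c.J q.1 + (c.γ q.1 + q.2) • c.e
  invFun x := (c.P x, inner ℝ c.e x - c.γ (c.P x))
  left_inv q := by
    have h1 : c.P (c.J q.1 + (c.γ q.1 + q.2) • c.e) = q.1 := by
      rw [map_add, map_smul, c.P_J, c.P_e, smul_zero, add_zero]
    ext1
    · exact h1
    · simp only [h1]
      rw [inner_add_right, c.inner_e_J, inner_smul_right, c.inner_e_e]
      ring
  right_inv x := by simp [c.decomp]
  continuous_toFun := by
    have := c.smooth.continuous
    have := c.J.continuous
    fun_prop
  continuous_invFun := by
    have := c.smooth.continuous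
    fun_prop

theorem straighten_apply (q : E2 × ℝ) :
    c.straighten q = c.J q.1 + (c.γ q.1 + q.2) • c.e := rfl

theorem straighten_zero (y : E2) : c.straighten (y, 0) = c.param y := by
  rw [straighten_apply, add_zero, param]

theorem defining_straighten (q : E2 × ℝ) : c.defining (c.straighten q) = -q.2 := by
  have h := congrArg Prod.snd (c.straighten.symm_apply_apply q)
  change inner ℝ c.e (c.straighten q) - c.γ (c.P (c.straighten q)) = q.2 at h
  rw [defining, ← h]
  ring

theorem contDiff_straighten : ContDiff ℝ ∞ c.straighten := by
  have h1 := c.smooth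
  have h2 : ContDiff ℝ ∞ c.J := c.J.toContinuousLinearMap.contDiff
  change ContDiff ℝ ∞ fun q : E2 × ℝ => c.J q.1 + (c.γ q.1 + q.2) • c.e
  fun_prop

theorem fderiv_straighten_apply (q : E2 × ℝ) (a : E2) (s : ℝ) :
    fderiv ℝ c.straighten q (a, s) = c.J a + (fderiv ℝ c.γ q.1 a + s) • c.e := by
  have h1 : HasFDerivAt (fun q : E2 × ℝ => c.γ q.1)
      ((fderiv ℝ c.γ q.1).comp (ContinuousLinearMap.fst ℝ E2 ℝ)) q :=
    ((c.smooth.differentiable (by simp)).differentiableAt.hasFDerivAt).comp q hasFDerivAt_fst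
  have h2 := ((c.J.toContinuousLinearMap.comp (ContinuousLinearMap.fst ℝ E2 ℝ)).hasFDerivAt
    (x := q)).add ((h1.add hasFDerivAt_snd).smul_const c.e)
  have h3 : fderiv ℝ c.straighten q = _ := HasFDerivAt.fderiv h2
  rw [h3]
  simp

/-- The map is a vertical shear followed by a linear isometry from the Euclidean product of the
plane and the line, so no Jacobian appears. -/
theorem measurePreserving_straighten : MeasurePreserving c.straighten volume volume := by
  let Λ : WithLp 2 (E2 × ℝ) ≃ₗᵢ[ℝ] E3 :=
    { toFun := fun q => c.J q.fst + q.snd • c.e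
      invFun := fun x => WithLp.toLp 2 (c.P x, inner ℝ c.e x)
      left_inv := fun q => by
        beta_reduce
        rw [map_add, map_smul, c.P_J, c.P_e, smul_zero, add_zero, inner_add_right, c.inner_e_J,
          inner_smul_right, c.inner_e_e, zero_add, mul_one]
        rfl
      right_inv := fun x => c.decomp x
      map_add' := fun q q' => by simp [add_smul]; abel
      map_smul' := fun a q => by simp [mul_smul]
      norm_map' := fun q => by
        change ‖c.J q.fst + q.snd • c.e‖ = ‖q‖
        rw [← sq_eq_sq₀ (norm_nonneg _) (norm_nonneg _), WithLp.prod_norm_sq_eq_of_L2,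
          norm_add_sq_real, c.J.norm_map, inner_smul_right, real_inner_comm, c.inner_e_J, norm_smul,
          c.norm_e]
        simp }
  have hshear : MeasurePreserving (fun q : E2 × ℝ => (q.1, c.γ q.1 + q.2)) volume volume := by
    refine (MeasurePreserving.id (volume : Measure E2)).skew_product (μc := (volume : Measure ℝ))
      (g := fun y s => c.γ y + s) ?_ ?_
    · have := c.smooth.continuous
      have h : Continuous fun q : E2 × ℝ => c.γ q.1 + q.2 := by fun_prop
      exact h.measurable
    · exact Eventually.of_forall fun y => (measurePreserving_add_left volume (c.γ y)).map_eq
  exact Λ.measurePreserving.comp ((WithLp.volume_preserving_toLp E2 ℝ).comp hshear)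

/-- Divergence theorem in the coordinates of a chart. -/
theorem setIntegral_fderiv_eq (hΩ : IsOpen Ω) {f : E3 → ℝ} (hf : ContDiff ℝ ∞ f) (hc : HasCompactSupport f)
    (hs : tsupport f ⊆ Metric.ball p c.r) (v : E3) :
    ∫ x in Ω, fderiv ℝ f x v = ∫ y, f (c.param y) * inner ℝ (c.grad (c.param y)) v := by
  set F : E2 × ℝ → ℝ := f ∘ c.straighten with hF
  have hFs : ContDiff ℝ ∞ F := hf.comp c.contDiff_straighten
  have hFc : HasCompactSupport F := hc.comp_homeomorph c.straighten
  have hFd : Differentiable ℝ F := hFs.differentiable (by simp)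
  set a := c.P v
  set b : ℝ := inner ℝ c.e v
  -- In straightened coordinates v becomes (a, b - Dγ a). The horizontal part integrates to zero on
  -- each slice; the vertical coefficient does not depend on the height, so the vertical part
  -- integrates to a boundary value.
  have hcomp : ∀ q, fderiv ℝ f (c.straighten q) v =
      fderiv ℝ F q (a, 0) + (b - fderiv ℝ c.γ q.1 a) * fderiv ℝ F q (0, 1) := by
    intro q
    have h1 : fderiv ℝ F q = (fderiv ℝ f (c.straighten q)).comp (fderiv ℝ c.straighten q) :=
      fderiv_comp q (hf.differentiable (by simp)).differentiableAt
        (c.contDiff_straighten.differentiable (by simp)).differentiableAt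
    rw [h1, ContinuousLinearMap.comp_apply, ContinuousLinearMap.comp_apply,
      fderiv_straighten_apply, fderiv_straighten_apply, ← smul_eq_mul, ← map_smul, ← map_add]
    congr 1
    conv_lhs => rw [← c.decomp v]
    simp only [map_zero, zero_add, add_zero, one_smul]
    rw [add_assoc, ← add_smul]
    congr 2
    ring
  have hfd : Continuous (fderiv ℝ F) := hFs.continuous_fderiv (by simp)
  have hγd : Continuous (fderiv ℝ c.γ) := c.smooth.continuous_fderiv (by simp)
  have hc1 : Continuous fun q => fderiv ℝ F q (a, 0) := by fun_prop
  have hc2 : Continuous fun q : E2 × ℝ =>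
      (b - fderiv ℝ c.γ q.1 a) * fderiv ℝ F q (0, 1) := by fun_prop
  have hi1 : Integrable (fun q => fderiv ℝ F q (a, 0)) :=
    hc1.integrable_of_hasCompactSupport (hFc.fderiv_apply ℝ _)
  have hi2 : Integrable fun q : E2 × ℝ => (b - fderiv ℝ c.γ q.1 a) * fderiv ℝ F q (0, 1) :=
    hc2.integrable_of_hasCompactSupport (hFc.fderiv_apply ℝ _).mul_left
  have hset : c.straighten ⁻¹' {x | c.defining x < 0} = Set.univ ×ˢ Set.Ioi (0 : ℝ) := by
    ext q
    simp [c.defining_straighten]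
  have hμ : (volume : Measure (E2 × ℝ)).restrict (Set.univ ×ˢ Set.Ioi (0 : ℝ)) =
      (volume : Measure E2).prod ((volume : Measure ℝ).restrict (Set.Ioi 0)) := by
    rw [Measure.volume_eq_prod, ← Measure.prod_restrict, Measure.restrict_univ]
  -- Since f is supported in the ball of the chart, Ω may be replaced by the whole epigraph.
  have hmove : ∫ x in Ω, fderiv ℝ f x v = ∫ x in {x | c.defining x < 0}, fderiv ℝ f x v := by
    have hΩind : ∀ S : Set E3, IsOpen S → ∫ x in S, fderiv ℝ f x v =
        ∫ x in S ∩ Metric.ball p c.r, fderiv ℝ f x v := by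
      intro S hS
      refine setIntegral_eq_of_subset_of_forall_sdiff_eq_zero hS.measurableSet
        Set.inter_subset_left fun x hx => ?_
      have hx' : x ∉ tsupport f := fun h => hx.2 ⟨hx.1, hs h⟩
      rw [image_eq_zero_of_notMem_tsupport fun h => hx' (tsupport_fderiv_subset ℝ h)]
      rfl
    rw [hΩind Ω hΩ, hΩind {x | c.defining x < 0}
      (isOpen_lt c.contDiff_defining.continuous continuous_const)]
    congr 2
    ext x
    exact and_congr_left fun hx => c.mem_iff_defining hx
  rw [hmove, ← c.measurePreserving_straighten.setIntegral_preimage_emb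
    c.straighten.measurableEmbedding, hset, hμ]
  simp only [hcomp]
  rw [integral_add (hμ ▸ hi1.integrableOn) (hμ ▸ hi2.integrableOn),
    integral_prod_symm _ (hμ ▸ hi1.integrableOn), integral_prod _ (hμ ▸ hi2.integrableOn)]
  have hz : ∀ s : ℝ, ∫ y, fderiv ℝ F (y, s) (a, 0) = 0 := by
    intro s
    have h1 : ∀ y, fderiv ℝ F (y, s) (a, 0) = fderiv ℝ (fun y => F (y, s)) y a := by
      intro y
      have := (hFd (y, s)).hasFDerivAt.comp y (hasFDerivAt_prodMk_left (𝕜 := ℝ) y s)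
      rw [show (fun y => F (y, s)) = F ∘ fun y => (y, s) from rfl, this.fderiv]
      simp
    simp only [h1]
    refine integral_fderiv_apply_eq_zero ?_ (HasCompactSupport.intro
      (hFc.isCompact.image continuous_fst) fun y hy => ?_) a
    · exact (hFs.comp (contDiff_prodMk_left s)).of_le (by simp)
    · exact image_eq_zero_of_notMem_tsupport fun h => hy ⟨(y, s), h, rfl⟩
  have hz2 : ∀ y : E2, ∫ s in Set.Ioi (0 : ℝ), (b - fderiv ℝ c.γ y a) * fderiv ℝ F (y, s) (0, 1) =
      f (c.param y) * inner ℝ (c.grad (c.param y)) v := by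
    intro y
    have h1 : ∀ s, fderiv ℝ F (y, s) (0, 1) = deriv (fun s => F (y, s)) s := by
      intro s
      have := (hFd (y, s)).hasFDerivAt.comp s (hasFDerivAt_prodMk_right (𝕜 := ℝ) y s)
      rw [show (fun s => F (y, s)) = F ∘ fun s => (y, s) from rfl, ← fderiv_apply_one_eq_deriv,
        this.fderiv]
      simp
    simp only [h1]
    rw [integral_const_mul, HasCompactSupport.integral_Ioi_deriv_eq, c.inner_grad, c.P_param]
    · simp only [hF, Function.comp_apply, c.straighten_zero]
      ring
    · exact (hFs.comp (contDiff_prodMk_right y)).of_le (by simp)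
    · refine HasCompactSupport.intro (hFc.isCompact.image continuous_snd) fun s hs => ?_
      exact image_eq_zero_of_notMem_tsupport fun h => hs ⟨(y, s), h, rfl⟩
  simp only [hz, hz2, integral_zero, zero_add]

/-- Surface integrals in the coordinates of a chart. -/
theorem integral_surfaceMeasure_eq (hΩ : IsOpen Ω) {h : E3 → ℝ}
    (hs : ∀ x ∉ Metric.ball p c.r, h x = 0) :
    ∫ x, h x ∂(surfaceMeasure Ω) = ∫ y, ‖c.grad (c.param y)‖ * h (c.param y) := by
  have hcont := c.contDiff_param.continuous
  have hg : Continuous fun y => ‖c.grad (c.param y)‖ :=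
    (c.contDiff_grad.continuous.comp hcont).norm
  rw [← setIntegral_eq_integral_of_forall_compl_eq_zero hs, c.surfaceMeasure_restrict_ball hΩ,
    setIntegral_eq_integral_of_forall_compl_eq_zero hs,
    (hcont.measurableEmbedding c.param_injective).integral_map,
    integral_withDensity_eq_integral_toReal_smul hg.measurable.ennreal_ofReal
      (Eventually.of_forall fun _ => ENNReal.ofReal_lt_top)]
  simp

theorem norm_grad_mul_inner_normal (x v : E3) :
    ‖c.grad x‖ * inner ℝ v (c.normal x) = inner ℝ (c.grad x) v := by
  rw [normal, inner_smul_right, ← mul_assoc, mul_inv_cancel₀ (c.norm_grad_pos x).ne', one_mul,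
    real_inner_comm]

/-- The area element ‖grad‖ cancels the normalisation of the unit normal. -/
theorem integral_mul_inner_outwardNormal_eq (hΩ : IsOpen Ω) {f : E3 → ℝ} {w : E3 → E3}
    (hs : tsupport f ⊆ Metric.ball p c.r) :
    ∫ x, f x * inner ℝ (w x) (outwardNormal Ω x) ∂(surfaceMeasure Ω) =
      ∫ y, f (c.param y) * inner ℝ (c.grad (c.param y)) (w (c.param y)) := by
  have hf0 : ∀ x ∉ Metric.ball p c.r, f x = 0 := fun x hx =>
    image_eq_zero_of_notMem_tsupport fun h => hx (hs h)
  rw [c.integral_surfaceMeasure_eq hΩ fun x hx => by rw [hf0 x hx, zero_mul]]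
  refine integral_congr_ae (Eventually.of_forall fun y => ?_)
  by_cases hy : c.param y ∈ Metric.ball p c.r
  · beta_reduce
    rw [c.outwardNormal_eq hΩ hy ((c.mem_frontier_iff hΩ hy).2 (c.defining_param y)),
      ← c.norm_grad_mul_inner_normal]
    ring
  · simp [hf0 _ hy]

theorem setIntegral_fderiv_eq_surface (hΩ : IsOpen Ω) {f : E3 → ℝ} (hf : ContDiff ℝ ∞ f)
    (hc : HasCompactSupport f) (hs : tsupport f ⊆ Metric.ball p c.r) (v : E3) :
    ∫ x in Ω, fderiv ℝ f x v =
      ∫ x, f x * inner ℝ v (outwardNormal Ω x) ∂(surfaceMeasure Ω) := by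
  rw [c.setIntegral_fderiv_eq hΩ hf hc hs, c.integral_mul_inner_outwardNormal_eq hΩ hs]

theorem surfaceMeasure_ball_lt_top (hΩ : IsOpen Ω) :
    surfaceMeasure Ω (Metric.ball p (c.r / 2)) < ⊤ := by
  have hcont := c.contDiff_param.continuous
  have hg : Continuous fun y => ‖c.grad (c.param y)‖ :=
    (c.contDiff_grad.continuous.comp hcont).norm
  have hsub : Metric.ball p (c.r / 2) ⊆ Metric.ball p c.r :=
    Metric.ball_subset_ball (by linarith [c.r_pos])
  have hm : MeasurableSet (Metric.ball p (c.r / 2)) := Metric.isOpen_ball.measurableSet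
  have h1 := congrArg (fun μ : Measure E3 => μ (Metric.ball p (c.r / 2)))
    (c.surfaceMeasure_restrict_ball hΩ)
  simp only [Measure.restrict_apply hm, Set.inter_eq_left.2 hsub] at h1
  rw [h1, Measure.map_apply hcont.measurable hm, withDensity_apply _ (hcont.measurable hm)]
  have hK : IsCompact (c.P '' Metric.closedBall p (c.r / 2)) :=
    (isCompact_closedBall _ _).image c.P.continuous
  have hsubK : c.param ⁻¹' Metric.ball p (c.r / 2) ⊆ c.P '' Metric.closedBall p (c.r / 2) :=
    fun y hy => ⟨c.param y, Metric.ball_subset_closedBall hy, c.P_param y⟩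
  have hint : IntegrableOn (fun y => ‖c.grad (c.param y)‖)
      (c.P '' Metric.closedBall p (c.r / 2)) volume := hg.continuousOn.integrableOn_compact hK
  have hint' := (hint.mono_set hsubK).lintegral_lt_top
  exact hint'

end GraphChart

namespace IsSmoothBoundedDomain

variable {Ω : Set E3} (hΩ : IsSmoothBoundedDomain Ω)
include hΩ

theorem isCompact_closure : IsCompact (closure Ω) := hΩ.isBounded.isCompact_closure

theorem isCompact_frontier : IsCompact (frontier Ω) :=
  hΩ.isCompact_closure.of_isClosed_subset isClosed_frontier frontier_subset_closure

theorem isFiniteMeasure_surfaceMeasure : IsFiniteMeasure (surfaceMeasure Ω) := by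
  constructor
  have h1 : surfaceMeasure Ω Set.univ = surfaceMeasure Ω (frontier Ω) := by
    rw [surfaceMeasure, Measure.restrict_apply_univ, Measure.restrict_apply_self]
  rw [h1]
  refine hΩ.isCompact_frontier.measure_lt_top_of_nhdsWithin fun p hp => ?_
  obtain ⟨c⟩ := hΩ.nonempty_graphChart hp
  exact ⟨_, mem_nhdsWithin_of_mem_nhds (Metric.ball_mem_nhds p (half_pos c.r_pos)),
    c.surfaceMeasure_ball_lt_top hΩ.isOpen⟩

theorem isFiniteMeasure_restrict : IsFiniteMeasure (volume.restrict Ω) :=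
  MeasureTheory.isFiniteMeasure_restrict.2 hΩ.isBounded.measure_lt_top.ne

omit hΩ in
theorem ae_mem_frontier : ∀ᵐ x ∂(surfaceMeasure Ω), x ∈ frontier Ω :=
  ae_restrict_mem isClosed_frontier.measurableSet

theorem integrable_surfaceMeasure_of_continuousOn {F : Type*} [NormedAddCommGroup F]
    {h : E3 → F} (hh : ContinuousOn h (frontier Ω)) : Integrable h (surfaceMeasure Ω) := by
  have := hΩ.isFiniteMeasure_surfaceMeasure
  have h1 : IntegrableOn h (frontier Ω) (surfaceMeasure Ω) :=
    hh.integrableOn_compact hΩ.isCompact_frontier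
  rwa [IntegrableOn, surfaceMeasure, Measure.restrict_restrict isClosed_frontier.measurableSet,
    Set.inter_self] at h1

theorem integrableOn_of_continuous {F : Type*} [NormedAddCommGroup F]
    {h : E3 → F} (hh : Continuous h) : IntegrableOn h Ω volume :=
  (hh.continuousOn.integrableOn_compact hΩ.isCompact_closure).mono_set subset_closure

/-- A partition of unity on the compact closure reduces to functions supported in a small ball:
inside Ω both sides are zero, and at a boundary point a chart applies. -/
theorem integral_fderiv_eq {f : E3 → ℝ} (hf : ContDiff ℝ ∞ f) (v : E3) :
    ∫ x in Ω, fderiv ℝ f x v =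
      ∫ x, f x * inner ℝ v (outwardNormal Ω x) ∂(surfaceMeasure Ω) := by
  have hloc : ∀ x ∈ closure Ω, ∃ r > 0, ∀ f : E3 → ℝ, ContDiff ℝ ∞ f → HasCompactSupport f →
      tsupport f ⊆ Metric.ball x r → ∫ x in Ω, fderiv ℝ f x v =
        ∫ x, f x * inner ℝ v (outwardNormal Ω x) ∂(surfaceMeasure Ω) := by
    intro x hx
    by_cases hxΩ : x ∈ Ω
    · obtain ⟨r, hr, hball⟩ := Metric.isOpen_iff.1 hΩ.isOpen x hxΩ
      refine ⟨r, hr, fun f hf hc hs => ?_⟩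
      have hsΩ : tsupport f ⊆ Ω := hs.trans hball
      rw [setIntegral_eq_integral_of_forall_compl_eq_zero fun y hy => by
          rw [image_eq_zero_of_notMem_tsupport fun h => hy (hsΩ (tsupport_fderiv_subset ℝ h))]; rfl,
        integral_fderiv_apply_eq_zero (hf.of_le (by simp)) hc, eq_comm]
      refine integral_eq_zero_of_ae ?_
      filter_upwards [ae_mem_frontier] with y hy
      have : y ∉ Ω := fun h => (hΩ.isOpen.frontier_eq ▸ hy).2 h
      simp [image_eq_zero_of_notMem_tsupport fun h => this (hsΩ h)]
    · obtain ⟨c⟩ := hΩ.nonempty_graphChart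
        (show x ∈ frontier Ω from hΩ.isOpen.frontier_eq ▸ ⟨hx, hxΩ⟩)
      exact ⟨c.r, c.r_pos, fun f hf hc hs => c.setIntegral_fderiv_eq_surface hΩ.isOpen hf hc hs v⟩
  choose! r hr hball using hloc
  obtain ⟨t, htcov⟩ := hΩ.isCompact_closure.elim_nhds_subcover'
    (fun x _ => Metric.ball x (r x)) fun x hx => Metric.ball_mem_nhds x (hr x hx)
  obtain ⟨ρ, hρ⟩ := SmoothPartitionOfUnity.exists_isSubordinate (modelWithCornersSelf ℝ E3)
    (isClosed_closure (s := Ω)) (fun i : t => Metric.ball (i.1.1 : E3) (r i.1.1))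
    (fun i => Metric.isOpen_ball) (fun x hx => by
      obtain ⟨i, hi, hxi⟩ := Set.mem_iUnion₂.1 (htcov hx)
      exact Set.mem_iUnion.2 ⟨⟨i, hi⟩, hxi⟩)
  have hsum : ∀ x ∈ closure Ω, ∑ i, ρ i x * f x = f x := fun x hx => by
    rw [← Finset.sum_mul, ← finsum_eq_sum_of_fintype, ρ.sum_eq_one hx, one_mul]
  have hsm : ∀ i, ContDiff ℝ ∞ fun x => ρ i x * f x := fun i =>
    (ρ i).contMDiff.contDiff.mul hf
  have hcs : ∀ i, HasCompactSupport fun x => ρ i x * f x := fun i => by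
    have : HasCompactSupport (ρ i) := (isCompact_closedBall (i.1.1 : E3) (r i.1.1)).of_isClosed_subset
      (isClosed_tsupport _) ((hρ i).trans Metric.ball_subset_closedBall)
    exact this.mul_right
  have hid : ∀ i, ∫ x in Ω, fderiv ℝ (fun x => ρ i x * f x) x v =
      ∫ x, ρ i x * f x * inner ℝ v (outwardNormal Ω x) ∂(surfaceMeasure Ω) := fun i =>
    hball i.1.1 i.1.2 _ (hsm i) (hcs i) ((tsupport_mul_subset_left).trans (hρ i))
  have h1 : ∫ x in Ω, fderiv ℝ f x v =
      ∫ x in Ω, ∑ i, fderiv ℝ (fun x => ρ i x * f x) x v := by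
    refine setIntegral_congr_fun hΩ.isOpen.measurableSet fun x hx => ?_
    have heq : f =ᶠ[𝓝 x] fun y => ∑ i, ρ i y * f y := by
      filter_upwards [hΩ.isOpen.mem_nhds hx] with y hy
      exact (hsum y (subset_closure hy)).symm
    beta_reduce
    rw [heq.fderiv_eq, fderiv_fun_sum fun i _ =>
      ((hsm i).differentiable (by simp)).differentiableAt, sum_apply]
  have h2 : ∫ x, f x * inner ℝ v (outwardNormal Ω x) ∂(surfaceMeasure Ω) =
      ∫ x, ∑ i, ρ i x * f x * inner ℝ v (outwardNormal Ω x) ∂(surfaceMeasure Ω) := by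
    refine integral_congr_ae ?_
    filter_upwards [ae_mem_frontier] with x hx
    rw [← Finset.sum_mul, hsum x (frontier_subset_closure hx)]
  rw [h1, h2, integral_finsetSum, integral_finsetSum]
  · exact Finset.sum_congr rfl fun i _ => hid i
  · exact fun i _ => hΩ.integrable_surfaceMeasure_of_continuousOn
      ((hsm i).continuous.continuousOn.mul
        (continuousOn_const.inner hΩ.continuousOn_outwardNormal))
  · exact fun i _ => hΩ.integrableOn_of_continuous
      (((hsm i).continuous_fderiv (by simp)).clm_apply continuous_const)

/-- The divergence theorem. -/
theorem integral_divergence_eq {F : E3 → E3} (hF : ContDiff ℝ ∞ F) :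
    ∫ x in Ω, divergence F x = ∫ x, inner ℝ (F x) (outwardNormal Ω x) ∂(surfaceMeasure Ω) := by
  have hcomp : ∀ i : Fin 3, ContDiff ℝ ∞ fun x => F x i := fun i =>
    (EuclideanSpace.proj (𝕜 := ℝ) i).contDiff.comp hF
  have hdiv : ∀ x, divergence F x =
      ∑ i : Fin 3, fderiv ℝ (fun x => F x i) x (EuclideanSpace.single i 1) := by
    intro x
    refine Finset.sum_congr rfl fun i _ => ?_
    have := (EuclideanSpace.proj i : E3 →L[ℝ] ℝ).hasFDerivAt.comp x
      (hF.differentiable (by simp) x).hasFDerivAt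
    rw [show (fun x => F x i) = (EuclideanSpace.proj i : E3 →L[ℝ] ℝ) ∘ F from rfl, this.fderiv]
    rfl
  have hinner : ∀ x, (inner ℝ (F x) (outwardNormal Ω x) : ℝ) =
      ∑ i : Fin 3, F x i * inner ℝ (EuclideanSpace.single i (1 : ℝ)) (outwardNormal Ω x) := by
    intro x
    rw [PiLp.inner_apply]
    refine Finset.sum_congr rfl fun i _ => ?_
    rw [EuclideanSpace.inner_single_left]
    simp [mul_comm]
  simp only [hdiv, hinner]
  rw [integral_finsetSum, integral_finsetSum]
  · exact Finset.sum_congr rfl fun i _ => hΩ.integral_fderiv_eq (hcomp i) _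
  · exact fun i _ => hΩ.integrable_surfaceMeasure_of_continuousOn
      ((hcomp i).continuous.continuousOn.mul
        (continuousOn_const.inner hΩ.continuousOn_outwardNormal))
  · exact fun i _ => hΩ.integrableOn_of_continuous
      (((hcomp i).continuous_fderiv (by simp)).clm_apply continuous_const)

end IsSmoothBoundedDomain

/-! ### Elements of Ker S are infinitesimal rigid motions. -/

section RigidMotions

/-- Antisymmetry of a linear map with respect to the inner product. -/
def IsAntisymmetric (A : E3 →L[ℝ] E3) : Prop := ∀ x y, (inner ℝ (A x) y : ℝ) = -inner ℝ x (A y)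

/-- A smooth field whose derivative is antisymmetric in a ball is an infinitesimal rigid motion
there. -/
theorem eq_affine_of_antisymmetric_fderiv {f : E3 → E3} (hf : ContDiff ℝ ∞ f) {x₀ : E3} {r : ℝ}
    (hr : 0 < r) (h : ∀ x ∈ Metric.ball x₀ r, IsAntisymmetric (fderiv ℝ f x)) :
    ∃ A : E3 →L[ℝ] E3, IsAntisymmetric A ∧ ∃ b, ∀ x ∈ Metric.ball x₀ r, f x = A x + b := by
  have hx₀ : x₀ ∈ Metric.ball x₀ r := Metric.mem_ball_self hr
  have hpre : IsPreconnected (Metric.ball x₀ r) := (convex_ball x₀ r).isPreconnected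
  have hfd : ContDiff ℝ ∞ (fderiv ℝ f) := hf.fderiv_right (by simp)
  have hfdd : Differentiable ℝ (fderiv ℝ f) := hfd.differentiable (by simp)
  have hanti : ∀ x ∈ Metric.ball x₀ r, ∀ a b z,
      (inner ℝ (fderiv ℝ (fderiv ℝ f) x a b) z : ℝ) =
        -inner ℝ (fderiv ℝ (fderiv ℝ f) x a z) b := by
    intro x hx a b z
    have hd : ∀ b z : E3, HasFDerivAt (fun y => (inner ℝ (fderiv ℝ f y b) z : ℝ))
        ((innerSL ℝ z).comp ((ContinuousLinearMap.apply ℝ E3 b).comp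
          (fderiv ℝ (fderiv ℝ f) x))) x := by
      intro b z
      have := (innerSL ℝ z).hasFDerivAt.comp x ((ContinuousLinearMap.apply ℝ E3 b).hasFDerivAt.comp
        x (hfdd x).hasFDerivAt)
      refine this.congr_of_eventuallyEq (Eventually.of_forall fun y => ?_)
      simp [real_inner_comm]
    have h0 : (fun y => (inner ℝ (fderiv ℝ f y b) z : ℝ) + inner ℝ (fderiv ℝ f y z) b) =ᶠ[𝓝 x]
        fun _ => 0 := by
      filter_upwards [Metric.isOpen_ball.mem_nhds hx] with y hy
      rw [h y hy b z, real_inner_comm, neg_add_cancel]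
    have := ((hd b z).add (hd z b)).unique
      ((hasFDerivAt_const (0 : ℝ) x).congr_of_eventuallyEq h0)
    have h1 := congrArg (fun T : E3 →L[ℝ] ℝ => T a) this
    simp only [add_apply, ContinuousLinearMap.comp_apply, ContinuousLinearMap.apply_apply,
      innerSL_apply_apply, zero_apply] at h1
    rw [real_inner_comm, real_inner_comm b]
    linarith
  have hsymm : ∀ x a b, fderiv ℝ (fderiv ℝ f) x a b = fderiv ℝ (fderiv ℝ f) x b a := fun x a b =>
    (hf.contDiffAt.isSymmSndFDerivAt
      (by simpa using WithTop.coe_le_coe.2 (OrderTop.le_top (2 : ℕ∞)))) a b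
  -- The form ⟨D²f(a, b), z⟩ is symmetric in a, b and antisymmetric in b, z. Permuting the arguments
  -- around shows that it equals its own negative.
  have hzero : Set.EqOn (fderiv ℝ (fderiv ℝ f)) 0 (Metric.ball x₀ r) := by
    intro x hx
    ext1 a
    ext1 b
    refine ext_inner_right ℝ fun z => ?_
    have h1 := hanti x hx a b z
    have h2 := hanti x hx z a b
    have h3 := hanti x hx b z a
    rw [hsymm x a z] at h1
    rw [hsymm x z b] at h2
    rw [hsymm x b a] at h3
    simp only [Pi.zero_apply, zero_apply, inner_zero_left]
    linarith
  have hconst : ∀ x ∈ Metric.ball x₀ r, fderiv ℝ f x = fderiv ℝ f x₀ := fun x hx =>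
    Metric.isOpen_ball.is_const_of_fderiv_eq_zero hpre hfdd.differentiableOn hzero hx hx₀
  refine ⟨fderiv ℝ f x₀, h x₀ hx₀, f x₀ - fderiv ℝ f x₀ x₀, fun x hx => ?_⟩
  have hfdiff : Differentiable ℝ f := hf.differentiable (by simp)
  have h1 : f x - fderiv ℝ f x₀ x = f x₀ - fderiv ℝ f x₀ x₀ := by
    refine Metric.isOpen_ball.is_const_of_fderiv_eq_zero (𝕜 := ℝ)
      (f := fun x => f x - fderiv ℝ f x₀ x) hpre (by fun_prop) (fun y hy => ?_) hx hx₀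
    rw [fderiv_fun_sub (hfdiff y) (fderiv ℝ f x₀).differentiableAt, ContinuousLinearMap.fderiv,
      hconst y hy, sub_self]
    rfl
  rw [← h1]
  abel

/-- A pointwise almost everywhere limit of infinitesimal rigid motions is one. -/
theorem ae_eq_affine_of_tendsto {V : Set E3} (hV : volume V ≠ 0) {A : ℕ → E3 →L[ℝ] E3}
    (hA : ∀ k, IsAntisymmetric (A k)) {b : ℕ → E3} {g : E3 → E3}
    (h : ∀ᵐ x ∂(volume.restrict V), Tendsto (fun k => A k x + b k) atTop (𝓝 (g x))) :
    ∃ A : E3 →L[ℝ] E3, IsAntisymmetric A ∧ ∃ b, ∀ᵐ x ∂(volume.restrict V), g x = A x + b := by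
  -- The points of convergence form an affine subspace. A proper one is Lebesgue-null, while
  -- convergence holds almost everywhere on a set of positive measure; so the sequence converges
  -- everywhere.
  let C : AffineSubspace ℝ E3 :=
    { carrier := {x | ∃ l, Tendsto (fun k => A k x + b k) atTop (𝓝 l)}
      smul_vsub_vadd_mem' := by
        rintro c x y z ⟨l₁, h₁⟩ ⟨l₂, h₂⟩ ⟨l₃, h₃⟩
        refine ⟨c • (l₁ - l₂) + l₃, (((h₁.sub h₂).const_smul c).add h₃).congr fun k => ?_⟩
        simp only [vsub_eq_sub, vadd_eq_add, map_add, map_smul, map_sub, add_sub_add_right_eq_sub]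
        abel }
  have hC : C = ⊤ := by
    by_contra hne
    have h0 := Measure.addHaar_affineSubspace volume C hne
    have h1 : ∀ᵐ x ∂(volume.restrict V), x ∈ (C : Set E3) := h.mono fun x hx => ⟨g x, hx⟩
    have h2 : ∀ᵐ x ∂(volume.restrict V), x ∉ (C : Set E3) :=
      ae_restrict_of_ae (measure_eq_zero_iff_ae_notMem.1 h0)
    have h3 : ∀ᵐ x ∂(volume.restrict V), False := by
      filter_upwards [h1, h2] with x hx hx' using hx' hx
    rw [eventually_false_iff_eq_bot, ae_eq_bot, Measure.restrict_eq_zero] at h3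
    exact hV h3
  have hex : ∀ x, ∃ l, Tendsto (fun k => A k x + b k) atTop (𝓝 l) := fun x => by
    have : x ∈ C := by rw [hC]; exact AffineSubspace.mem_top ℝ E3 x
    exact this
  choose l hl using hex
  have hlin : ∀ x, Tendsto (fun k => A k x) atTop (𝓝 (l x - l 0)) := fun x =>
    ((hl x).sub (hl 0)).congr fun k => by simp
  let T : E3 →ₗ[ℝ] E3 :=
    { toFun := fun x => l x - l 0
      map_add' := fun x y => tendsto_nhds_unique (hlin (x + y))
        (((hlin x).add (hlin y)).congr fun k => by simp)
      map_smul' := fun c x => tendsto_nhds_unique (hlin (c • x))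
        (((hlin x).const_smul c).congr fun k => by simp) }
  refine ⟨LinearMap.toContinuousLinearMap T, fun x y => ?_, l 0, ?_⟩
  · have h1 := (hlin x).inner (𝕜 := ℝ) (tendsto_const_nhds (x := y))
    have h2 := ((tendsto_const_nhds (x := x)).inner (𝕜 := ℝ) (hlin y)).neg
    exact tendsto_nhds_unique h1 (h2.congr fun k => (hA k x y).symm)
  · filter_upwards [h] with x hx
    have := tendsto_nhds_unique hx (hl x)
    simp [T, this]

theorem affine_unique {V : Set E3} (hV : IsOpen V) (hne : V.Nonempty) {A A' : E3 →L[ℝ] E3}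
    {b b' : E3} (h : ∀ᵐ x ∂(volume.restrict V), A x + b = A' x + b') : A = A' ∧ b = b' := by
  have h1 : Set.EqOn (fun x => A x + b) (fun x => A' x + b') V :=
    Measure.eqOn_open_of_ae_eq h hV (by fun_prop) (by fun_prop)
  obtain ⟨x, hx⟩ := hne
  have h2 : (fun x => A x + b) =ᶠ[𝓝 x] fun x => A' x + b' := h1.eventuallyEq_of_mem (hV.mem_nhds hx)
  have h3 := h2.fderiv_eq (𝕜 := ℝ)
  rw [fderiv_add_const, fderiv_add_const, ContinuousLinearMap.fderiv,
    ContinuousLinearMap.fderiv] at h3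
  refine ⟨h3, ?_⟩
  have h4 := h1 hx
  simpa [h3] using h4

/-- The mollification of an element of `Ker S` has antisymmetric derivative where the mollifier
does not see the complement of `Ω`. -/
theorem isAntisymmetric_fderiv_convolution {Ω : Set E3} (hΩ : MeasurableSet Ω) {w : L2 Ω}
    (hw : w ∈ kerS Ω) (hint : LocallyIntegrable (Ω.indicator w) volume) {ρ : E3 → ℝ}
    (hρ : ContDiff ℝ ∞ ρ) (hc : HasCompactSupport ρ) {x : E3}
    (hx : ∀ t ∈ tsupport ρ, x - t ∈ Ω) :
    IsAntisymmetric (fderiv ℝ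
      (convolution ρ (Ω.indicator w) (ContinuousLinearMap.lsmul ℝ ℝ) volume) x) := by
  set L : ℝ →L[ℝ] E3 →L[ℝ] E3 := ContinuousLinearMap.lsmul ℝ ℝ with hL
  set W := Ω.indicator w
  have hd := hc.hasFDerivAt_convolution_left L (hρ.of_le (by simp)) hint x
  have hex : ConvolutionExists (fderiv ℝ ρ) W (L.precompL E3) volume :=
    (hc.fderiv ℝ).convolutionExists_left _ (hρ.continuous_fderiv (by simp)) hint
  have happ : ∀ u v : E3, (inner ℝ (fderiv ℝ (convolution ρ W L volume) x u) v : ℝ) =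
      ∫ t, inner ℝ (W (x - t)) v * fderiv ℝ ρ t u := by
    intro u v
    rw [hd.fderiv, convolution_def, ContinuousLinearMap.integral_apply (hex x), real_inner_comm,
      ← integral_inner]
    · refine integral_congr_ae (Eventually.of_forall fun t => ?_)
      simp [hL, inner_smul_right, real_inner_comm, mul_comm]
    · exact (ContinuousLinearMap.apply ℝ E3 u).integrable_comp (hex x)
  have hint' : ∀ u v : E3, Integrable fun t => (inner ℝ (W (x - t)) v : ℝ) * fderiv ℝ ρ t u := by
    intro u v
    have h1 := (innerSL ℝ v).integrable_comp
      ((ContinuousLinearMap.apply ℝ E3 u).integrable_comp (hex x))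
    refine h1.congr (Eventually.of_forall fun t => ?_)
    simp [hL, real_inner_comm, mul_comm]
  -- The reflected translate of the mollifier is the test function that turns the distributional
  -- condition Sw = 0 into antisymmetry at x.
  set φ : E3 → ℝ := fun y => ρ (x - y) with hφ
  have hφs : ContDiff ℝ ∞ φ := hρ.comp (contDiff_const.sub contDiff_id)
  have hφc : HasCompactSupport φ := hc.comp_homeomorph (Homeomorph.subLeft x)
  have hφt : tsupport φ ⊆ Ω := by
    intro y hy
    have := (tsupport_comp_eq_preimage ρ (Homeomorph.subLeft x)) ▸ hy
    simpa using hx _ this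
  have hφd : ∀ y u, fderiv ℝ φ y u = -fderiv ℝ ρ (x - y) u := by
    intro y u
    have h1 : HasFDerivAt (fun y => x - y) (-ContinuousLinearMap.id ℝ E3) y :=
      (hasFDerivAt_id y).const_sub x
    have h2 := (hρ.differentiable (by simp) (x - y)).hasFDerivAt.comp y h1
    rw [show φ = ρ ∘ fun y => x - y from rfl, h2.fderiv]
    simp
  intro u v
  have hk := hw.2 φ hφs hφc hφt u v
  rw [real_inner_comm (fderiv ℝ (convolution ρ W L volume) x v) u]
  rw [eq_neg_iff_add_eq_zero, happ, happ, ← integral_add (hint' u v) (hint' v u)]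
  rw [← integral_indicator hΩ, ← integral_sub_left_eq_self _ volume x] at hk
  rw [← neg_eq_zero, ← integral_neg, ← hk]
  refine integral_congr_ae (Eventually.of_forall fun t => ?_)
  by_cases ht : x - t ∈ Ω
  · simp [W, Set.indicator_of_mem ht, hφd]
  · simp [W, Set.indicator_of_notMem ht]

/-- The mollifications of w are rigid motions on a fixed ball and converge to w almost everywhere,
so the limit is one too. -/
theorem kerS_locally_affine {Ω : Set E3} (hΩ : IsSmoothBoundedDomain Ω) {w : L2 Ω}
    (hw : w ∈ kerS Ω) {x₀ : E3} (hx₀ : x₀ ∈ Ω) :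
    ∃ r > 0, Metric.ball x₀ r ⊆ Ω ∧ ∃ A : E3 →L[ℝ] E3, IsAntisymmetric A ∧
      ∃ b, ∀ᵐ x ∂(volume.restrict (Metric.ball x₀ r)), w x = A x + b := by
  obtain ⟨R, hR, hball⟩ := Metric.isOpen_iff.1 hΩ.isOpen x₀ hx₀
  have hm := hΩ.isOpen.measurableSet
  have := hΩ.isFiniteMeasure_restrict
  have hint : LocallyIntegrable (Ω.indicator w) volume :=
    ((integrable_indicator_iff hm).2 ((Lp.memLp w).integrable one_le_two)).locallyIntegrable
  have hsub : Metric.ball x₀ (R / 2) ⊆ Ω :=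
    (Metric.ball_subset_ball (by linarith)).trans hball
  refine ⟨R / 2, half_pos hR, hsub, ?_⟩
  -- An outer radius of at most R / 4 keeps the mollification at points of the ball of radius R / 2
  -- inside the ball of radius R. The ratio 2 of outer to inner radius is what the almost everywhere
  -- convergence needs to be bounded.
  let φ : ℕ → ContDiffBump (0 : E3) := fun k =>
    ⟨R / 8 / (k + 1), R / 4 / (k + 1), by positivity, by gcongr; linarith⟩
  have hlim : Tendsto (fun k => (φ k).rOut) atTop (𝓝 0) := by
    have := (tendsto_one_div_add_atTop_nhds_zero_nat (𝕜 := ℝ)).const_mul (R / 4)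
    simpa [φ, div_eq_mul_inv] using this
  have hconv := ContDiffBump.ae_convolution_tendsto_right_of_locallyIntegrable (μ := volume)
    (K := 2) hlim (Eventually.of_forall fun k => le_of_eq (by simp only [φ]; ring)) hint
  have hrle : ∀ k, (φ k).rOut ≤ R / 4 := fun k => by
    simp only [φ]
    exact div_le_self (by positivity) (by linarith [(Nat.cast_nonneg k : (0 : ℝ) ≤ k)])
  have haff : ∀ k, ∃ A : E3 →L[ℝ] E3, IsAntisymmetric A ∧ ∃ b, ∀ x ∈ Metric.ball x₀ (R / 2),
      convolution ((φ k).normed volume) (Ω.indicator w) (ContinuousLinearMap.lsmul ℝ ℝ) volume x =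
        A x + b := by
    intro k
    refine eq_affine_of_antisymmetric_fderiv ?_ (half_pos hR) fun x hx =>
      isAntisymmetric_fderiv_convolution hm hw hint (φ k).contDiff_normed
        (φ k).hasCompactSupport_normed fun t ht => hball ?_
    · exact (φ k).hasCompactSupport_normed.contDiff_convolution_left _ (φ k).contDiff_normed hint
    · rw [(φ k).tsupport_normed_eq, mem_closedBall_zero_iff] at ht
      rw [mem_ball_iff_norm] at hx ⊢
      calc ‖x - t - x₀‖ = ‖(x - x₀) - t‖ := by congr 1; abel
        _ ≤ ‖x - x₀‖ + ‖t‖ := norm_sub_le _ _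
        _ < R := by linarith [hrle k]
  choose A hA b hb using haff
  refine ae_eq_affine_of_tendsto (Metric.measure_ball_pos volume x₀ (half_pos hR)).ne' hA (b := b) ?_
  filter_upwards [ae_restrict_of_ae hconv, ae_restrict_mem measurableSet_ball] with x hx hxB
  rw [Set.indicator_of_mem (hsub hxB)] at hx
  exact hx.congr fun k => hb k x hxB

/-- The elements of `Ker S` are infinitesimal rigid motions. -/
theorem exists_affine_of_mem_kerS {Ω : Set E3} (hΩ : IsSmoothBoundedDomain Ω) {w : L2 Ω}
    (hw : w ∈ kerS Ω) : ∃ A : E3 →L[ℝ] E3, IsAntisymmetric A ∧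
      ∃ b, ∀ᵐ x ∂(volume.restrict Ω), w x = A x + b := by
  have hloc := fun x (hx : x ∈ Ω) => kerS_locally_affine hΩ hw hx
  choose! r hr hball A hA b hb using hloc
  obtain ⟨x₀, hx₀⟩ := hΩ.isConnected.nonempty
  -- Balls around nearby points overlap in a nonempty open set, where an affine map is determined by
  -- its values; so the coefficients are locally constant on the connected set Ω.
  have hconst : ∀ x ∈ Ω, A x = A x₀ ∧ b x = b x₀ := by
    intro x hx
    refine hΩ.isConnected.isPreconnected.induction₂ (fun x y => A x = A y ∧ b x = b y) ?_
      (fun x y z _ _ _ h h' => ⟨h.1.trans h'.1, h.2.trans h'.2⟩)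
      (fun x y _ _ h => ⟨h.1.symm, h.2.symm⟩) hx hx₀
    intro x hx
    filter_upwards [mem_nhdsWithin_of_mem_nhds (Metric.ball_mem_nhds x (hr x hx)),
      self_mem_nhdsWithin] with y hy hyΩ
    refine affine_unique (Metric.isOpen_ball.inter Metric.isOpen_ball)
      ⟨y, hy, Metric.mem_ball_self (hr y hyΩ)⟩ ?_
    filter_upwards [ae_restrict_of_ae_restrict_of_subset Set.inter_subset_left (hb x hx),
      ae_restrict_of_ae_restrict_of_subset Set.inter_subset_right (hb y hyΩ)] with z h1 h2
    rw [← h1, ← h2]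
  refine ⟨A x₀, hA x₀ hx₀, b x₀, ?_⟩
  have hcover := TopologicalSpace.countable_cover_nhdsWithin
    (f := fun x => Metric.ball x (r x)) (s := Ω)
    fun x hx => mem_nhdsWithin_of_mem_nhds (Metric.ball_mem_nhds x (hr x hx))
  obtain ⟨t, htΩ, htc, ht⟩ := hcover
  refine ae_restrict_of_ae_restrict_of_subset ht ?_
  rw [ae_restrict_biUnion_iff _ htc]
  intro x hx
  filter_upwards [hb x (htΩ hx)] with y hy
  rw [hy, (hconst x (htΩ hx)).1, (hconst x (htΩ hx)).2]

end RigidMotions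

/-! ### Integral identities for solenoidal and antisymmetric fields. -/

theorem divergence_smul {φ : E3 → ℝ} {F : E3 → E3} {x : E3} (hφ : DifferentiableAt ℝ φ x)
    (hF : DifferentiableAt ℝ F x) :
    divergence (fun y => φ y • F y) x = fderiv ℝ φ x (F x) + φ x * divergence F x := by
  have hx : fderiv ℝ φ x (F x) = ∑ i, fderiv ℝ φ x (EuclideanSpace.single i 1) * F x i := by
    have h : F x = ∑ i, F x i • EuclideanSpace.single i (1 : ℝ) := by
      have := (EuclideanSpace.basisFun (Fin 3) ℝ).sum_repr (F x)
      simpa using this.symm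
    conv_lhs => rw [h]
    simp [mul_comm]
  rw [hx, divergence, divergence, Finset.mul_sum, ← Finset.sum_add_distrib]
  refine Finset.sum_congr rfl fun i _ => ?_
  rw [fderiv_fun_smul hφ hF]
  simp
  ring

theorem frobenius_comm (A B : E3 →L[ℝ] E3) : frobenius A B = frobenius B A :=
  Finset.sum_congr rfl fun _ _ => real_inner_comm _ _

theorem IsAntisymmetric.inner_self {A : E3 →L[ℝ] E3} (hA : IsAntisymmetric A) (x : E3) :
    (inner ℝ (A x) x : ℝ) = 0 := by
  have := hA x x
  rw [real_inner_comm] at this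
  rw [real_inner_comm]
  linarith

theorem IsAntisymmetric.smul {A : E3 →L[ℝ] E3} (hA : IsAntisymmetric A) (c : ℝ) :
    IsAntisymmetric (c • A) := fun x y => by
  simp [inner_smul_left, inner_smul_right, hA x y]

theorem hasFDerivAt_affine (A : E3 →L[ℝ] E3) (b x : E3) : HasFDerivAt (fun x => A x + b) A x :=
  A.hasFDerivAt.add_const b

theorem contDiff_affine (A : E3 →L[ℝ] E3) (b : E3) : ContDiff ℝ ∞ fun x => A x + b :=
  A.contDiff.add contDiff_const

theorem IsAntisymmetric.divergence_affine {A : E3 →L[ℝ] E3} (hA : IsAntisymmetric A) (b x : E3) :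
    divergence (fun x => A x + b) x = 0 := by
  refine Finset.sum_eq_zero fun i _ => ?_
  rw [(hasFDerivAt_affine A b x).fderiv]
  have := hA.inner_self (EuclideanSpace.single i 1)
  rw [EuclideanSpace.inner_single_right] at this
  simpa using this

namespace IsSmoothBoundedDomain

variable {Ω : Set E3} (hΩ : IsSmoothBoundedDomain Ω)
include hΩ

theorem integral_fderiv_of_solenoidal {φ : E3 → ℝ} (hφ : ContDiff ℝ ∞ φ) {F : E3 → E3}
    (hF : ContDiff ℝ ∞ F) (hdiv : ∀ x ∈ Ω, divergence F x = 0) :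
    ∫ x in Ω, fderiv ℝ φ x (F x) =
      ∫ x, φ x * inner ℝ (F x) (outwardNormal Ω x) ∂(surfaceMeasure Ω) := by
  have h := hΩ.integral_divergence_eq (F := fun x => φ x • F x) (hφ.smul hF)
  simp only [inner_smul_left] at h
  refine Eq.trans (setIntegral_congr_fun hΩ.isOpen.measurableSet fun x hx => ?_) h
  have := divergence_smul (hφ.differentiable (by simp) x) (hF.differentiable (by simp) x)
  rw [hdiv x hx, mul_zero, add_zero] at this
  exact this.symm

/-- Solenoidal tangent fields are orthogonal to gradients. -/
theorem integral_fderiv_eq_zero_of_tangent {φ : E3 → ℝ} (hφ : ContDiff ℝ ∞ φ) {F : E3 → E3}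
    (hF : ContDiff ℝ ∞ F) (hdiv : ∀ x ∈ Ω, divergence F x = 0)
    (ht : ∀ x ∈ frontier Ω, (inner ℝ (F x) (outwardNormal Ω x) : ℝ) = 0) :
    ∫ x in Ω, fderiv ℝ φ x (F x) = 0 := by
  rw [hΩ.integral_fderiv_of_solenoidal hφ hF hdiv]
  refine integral_eq_zero_of_ae ?_
  filter_upwards [ae_mem_frontier] with x hx
  simp [ht x hx]

/-- A smooth solenoidal field with vanishing weak normal trace is tangent to the boundary. -/
theorem tangent_of_integral_fderiv_eq_zero {F : E3 → E3}
    (hF : ContDiff ℝ ∞ F) (hdiv : ∀ x ∈ Ω, divergence F x = 0)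
    (h : ∀ φ : E3 → ℝ, ContDiff ℝ ∞ φ → HasCompactSupport φ → ∫ x in Ω, fderiv ℝ φ x (F x) = 0)
    {p : E3} (hp : p ∈ frontier Ω) : (inner ℝ (F p) (outwardNormal Ω p) : ℝ) = 0 := by
  obtain ⟨c⟩ := hΩ.nonempty_graphChart hp
  let χ : ContDiffBump p := ⟨c.r / 4, c.r / 2, by linarith [c.r_pos], by linarith [c.r_pos]⟩
  set k : E3 → ℝ := fun x => inner ℝ (c.grad x) (F x)
  have hk : ContDiff ℝ ∞ k := c.contDiff_grad.inner ℝ hF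
  -- Testing with a cutoff times the unnormalised normal component k makes the boundary integrand
  -- χk², which is nonnegative and positive at p unless k vanishes there.
  have hf : ContDiff ℝ ∞ fun x => χ x * k x := χ.contDiff.mul hk
  have hfc : HasCompactSupport fun x => χ x * k x := χ.hasCompactSupport.mul_right
  have hfs : tsupport (fun x => χ x * k x) ⊆ Metric.ball p c.r := by
    refine tsupport_mul_subset_left.trans ?_
    rw [χ.tsupport_eq]
    exact Metric.closedBall_subset_ball (by simp only [χ]; linarith [c.r_pos])
  have h0 := h _ hf hfc
  rw [hΩ.integral_fderiv_of_solenoidal hf hF hdiv,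
    c.integral_mul_inner_outwardNormal_eq hΩ.isOpen hfs] at h0
  by_contra hne
  have hpar : c.param (c.P p) = p :=
    c.param_P ((c.mem_frontier_iff hΩ.isOpen c.mem_ball_self).1 hp)
  have hpos : 0 < ∫ y, χ (c.param y) * k (c.param y) * k (c.param y) := by
    have hcont := c.contDiff_param.continuous
    refine Continuous.integral_pos_of_hasCompactSupport_nonneg_nonzero (x := c.P p) ?_ ?_ ?_ ?_
    · exact (hf.continuous.comp hcont).mul (hk.continuous.comp hcont)
    · refine HasCompactSupport.intro (hfc.isCompact.image c.P.continuous) fun y hy => ?_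
      have : c.param y ∉ tsupport fun x => χ x * k x := fun hmem =>
        hy ⟨c.param y, hmem, c.P_param y⟩
      have := image_eq_zero_of_notMem_tsupport this
      simp only [this, zero_mul]
    · intro y
      have := mul_nonneg (χ.nonneg (x := c.param y)) (mul_self_nonneg (k (c.param y)))
      simpa [mul_assoc] using this
    · have hkp : k p ≠ 0 := by
        simp only [k]
        rw [c.inner_grad_eq hΩ.isOpen hp]
        exact mul_ne_zero (c.norm_grad_pos p).ne' hne
      have hχ : χ p = 1 := χ.one_of_mem_closedBall (Metric.mem_closedBall_self χ.rIn_pos.le)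
      rw [hpar, hχ, one_mul]
      exact mul_ne_zero hkp hkp
  exact hpos.ne' h0

/-- For constant antisymmetric A one has A : DF = div(-AF), and the flux of -AF through the boundary
is F · A𝐧. -/
theorem integral_frobenius_antisymmetric {A : E3 →L[ℝ] E3} (hA : IsAntisymmetric A)
    {F : E3 → E3} (hF : ContDiff ℝ ∞ F) :
    ∫ x in Ω, frobenius A (fderiv ℝ F x) =
      ∫ x, inner ℝ (F x) (A (outwardNormal Ω x)) ∂(surfaceMeasure Ω) := by
  have hG : ContDiff ℝ ∞ fun x => -A (F x) := (A.contDiff.comp hF).neg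
  have h := hΩ.integral_divergence_eq hG
  have h1 : ∀ x, divergence (fun x => -A (F x)) x = frobenius A (fderiv ℝ F x) := by
    intro x
    have hd : HasFDerivAt (fun x => -A (F x)) (-(A.comp (fderiv ℝ F x))) x :=
      (A.hasFDerivAt.comp x (hF.differentiable (by simp) x).hasFDerivAt).neg
    refine Finset.sum_congr rfl fun i _ => ?_
    rw [hd.fderiv]
    have h2 := hA (fderiv ℝ F x (EuclideanSpace.single i 1)) (EuclideanSpace.single i 1)
    rw [EuclideanSpace.inner_single_right] at h2
    rw [real_inner_comm]
    simp at h2 ⊢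
    linarith
  simp only [h1] at h
  rw [h]
  refine integral_congr_ae (Eventually.of_forall fun x => ?_)
  beta_reduce
  rw [inner_neg_left, hA, neg_neg]

omit hΩ in
theorem aestronglyMeasurable_surfaceMeasure {F : Type*} [NormedAddCommGroup F]
    {h : E3 → F} (hh : ContinuousOn h (frontier Ω)) : AEStronglyMeasurable h (surfaceMeasure Ω) :=
  hh.aestronglyMeasurable isClosed_frontier.measurableSet

theorem memLp_surfaceMeasure {F : Type*} [NormedAddCommGroup F]
    {h : E3 → F} (hh : ContinuousOn h (frontier Ω)) : MemLp h 2 (surfaceMeasure Ω) := by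
  have := hΩ.isFiniteMeasure_surfaceMeasure
  obtain ⟨C, hC⟩ := hΩ.isCompact_frontier.exists_bound_of_continuousOn hh
  refine MemLp.of_bound (aestronglyMeasurable_surfaceMeasure hh) C ?_
  filter_upwards [ae_mem_frontier] with x hx using hC x hx

theorem memLp_restrict {F : Type*} [NormedAddCommGroup F]
    {h : E3 → F} (hh : Continuous h) : MemLp h 2 (volume.restrict Ω) := by
  have := hΩ.isFiniteMeasure_restrict
  obtain ⟨C, hC⟩ := hΩ.isCompact_closure.exists_bound_of_continuousOn hh.continuousOn
  refine MemLp.of_bound hh.aestronglyMeasurable C ?_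
  filter_upwards [ae_restrict_mem hΩ.isOpen.measurableSet] with x hx using hC x (subset_closure hx)

end IsSmoothBoundedDomain

/-- On a finite measure space L² convergence implies L¹ convergence, and bounded functionals
preserve it. This carries integral identities for smooth fields over to weak Jacobians and traces.
-/
theorem tendsto_integral_of_tendsto_eLpNorm_two {X E : Type*} [MeasurableSpace X]
    {μ : Measure X} [IsFiniteMeasure μ] [NormedAddCommGroup E] [NormedSpace ℝ E]
    {T : X → E →L[ℝ] ℝ} (hT : AEStronglyMeasurable T μ) {C : ℝ} (hC : ∀ᵐ x ∂μ, ‖T x‖ ≤ C)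
    {f : ℕ → X → E} {g : X → E} (hf : ∀ k, MemLp (f k) 2 μ) (hg : MemLp g 2 μ)
    (h : Tendsto (fun k => eLpNorm (fun x => f k x - g x) 2 μ) atTop (𝓝 0)) :
    Tendsto (fun k => ∫ x, T x (f k x) ∂μ) atTop (𝓝 (∫ x, T x (g x) ∂μ)) := by
  have hmeas : ∀ {u : X → E}, AEStronglyMeasurable u μ →
      AEStronglyMeasurable (fun x => T x (u x)) μ := fun hu =>
    (ContinuousLinearMap.apply ℝ ℝ).aestronglyMeasurable_comp₂ hu hT
  have hbound : ∀ {u : X → E}, AEStronglyMeasurable u μ →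
      eLpNorm (fun x => T x (u x)) 1 μ ≤ ENNReal.ofReal C *
        (eLpNorm u 2 μ * μ Set.univ ^ (1 / (1 : ℝ≥0∞).toReal - 1 / (2 : ℝ≥0∞).toReal)) := by
    intro u hu
    refine (eLpNorm_le_mul_eLpNorm_of_ae_le_mul (c := C) (g := u) ?_ 1).trans ?_
    · filter_upwards [hC] with x hx
      exact ((T x).le_opNorm _).trans (by gcongr)
    · gcongr
      exact eLpNorm_le_eLpNorm_mul_rpow_measure_univ one_le_two hu
  have hint : ∀ {u : X → E}, MemLp u 2 μ → Integrable (fun x => T x (u x)) μ := by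
    intro u hu
    rw [← memLp_one_iff_integrable]
    refine ⟨hmeas hu.1, (hbound hu.1).trans_lt ?_⟩
    refine ENNReal.mul_lt_top ENNReal.ofReal_lt_top (ENNReal.mul_lt_top hu.2 ?_)
    exact ENNReal.rpow_lt_top_of_nonneg (by norm_num) (measure_ne_top _ _)
  refine tendsto_integral_of_L1' _ (hint hg).aestronglyMeasurable
    (Eventually.of_forall fun k => hint (hf k)) ?_
  refine tendsto_of_tendsto_of_tendsto_of_le_of_le tendsto_const_nhds ?_ (fun _ => zero_le)
    (fun k => ?_) (g := fun _ => 0) (h := fun k => ENNReal.ofReal C *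
      (eLpNorm (fun x => f k x - g x) 2 μ *
        μ Set.univ ^ (1 / (1 : ℝ≥0∞).toReal - 1 / (2 : ℝ≥0∞).toReal)))
  · have h1 := ENNReal.Tendsto.const_mul (a := ENNReal.ofReal C)
      (ENNReal.Tendsto.mul_const (b := μ Set.univ ^ (1 / (1 : ℝ≥0∞).toReal - 1 / (2 : ℝ≥0∞).toReal))
        h (Or.inr (ENNReal.rpow_lt_top_of_nonneg (by norm_num) (measure_ne_top _ _)).ne))
      (Or.inr ENNReal.ofReal_ne_top)
    simpa using h1
  · refine le_trans (le_of_eq ?_) (hbound ((hf k).1.sub hg.1))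
    congr 1
    ext x
    simp

/-! ### Vanishing of the viscous and convective terms for tangent rigid motions. -/

section RigidFields

variable {Ω : Set E3} (hΩ : IsSmoothBoundedDomain Ω) {A : E3 →L[ℝ] E3} (hA : IsAntisymmetric A)
  {b : E3}
include hΩ hA

theorem tangent_of_mem_kerS {w : L2 Ω} (hw : w ∈ kerS Ω)
    (hwA : ∀ᵐ x ∂(volume.restrict Ω), w x = A x + b) :
    ∀ x ∈ frontier Ω, (inner ℝ (A x + b) (outwardNormal Ω x) : ℝ) = 0 := by
  refine fun x hx => hΩ.tangent_of_integral_fderiv_eq_zero (contDiff_affine A b)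
    (fun y _ => hA.divergence_affine b y) (fun φ hφ hc => ?_) hx
  rw [← hw.1 φ hφ hc]
  refine integral_congr_ae ?_
  filter_upwards [hwA] with y hy
  rw [hy]

/-- Here the derivative of the field is A itself. The normal part of v drops out because A𝐧 · 𝐧 = 0.
-/
theorem inner_shapeOperator_rigid
    (ht : ∀ x ∈ frontier Ω, (inner ℝ (A x + b) (outwardNormal Ω x) : ℝ) = 0)
    {p : E3} (hp : p ∈ frontier Ω) (v : E3) :
    (inner ℝ (A p + b) (shapeOperator Ω p v) : ℝ) = inner ℝ v (A (outwardNormal Ω p)) := by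
  rw [hΩ.inner_shapeOperator_of_tangent (w := fun x => A x + b) hp (hasFDerivAt_affine A b p) ht,
    map_sub, map_smul, inner_sub_left, inner_smul_left, hA.inner_self, mul_zero, sub_zero, hA v,
    neg_neg]

/-- The viscous form vanishes when tested with a tangent infinitesimal rigid motion. -/
theorem viscousForm_rigid_left
    (ht : ∀ x ∈ frontier Ω, (inner ℝ (A x + b) (outwardNormal Ω x) : ℝ) = 0)
    {U : L2 Ω × L2Mat Ω} {g : Lp E3 2 (surfaceMeasure Ω)} (hU : IsBoundaryTrace Ω U g) :
    viscousForm Ω (fun _ => 0) (fun x => A x + b) U g = 0 := by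
  obtain ⟨f, hf, -, hDf, hfg⟩ := hU
  have := hΩ.isFiniteMeasure_surfaceMeasure
  have := hΩ.isFiniteMeasure_restrict
  let Fr : (E3 →L[ℝ] E3) →L[ℝ] ℝ := ∑ i : Fin 3,
    (innerSL ℝ (A (EuclideanSpace.single i 1))).comp
      (ContinuousLinearMap.apply ℝ E3 (EuclideanSpace.single i 1))
  have hFr : ∀ B, Fr B = frobenius A B := fun B => by
    simp [Fr, frobenius, sum_apply]
  have h1 : Tendsto (fun k => ∫ x in Ω, frobenius A (fderiv ℝ (f k) x)) atTop
      (𝓝 (∫ x in Ω, frobenius A (U.2 x))) := by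
    simp only [← hFr]
    exact tendsto_integral_of_tendsto_eLpNorm_two (T := fun _ => Fr) (C := ‖Fr‖)
      aestronglyMeasurable_const (Eventually.of_forall fun _ => le_rfl)
      (fun k => hΩ.memLp_restrict ((hf k).continuous_fderiv (by simp))) (Lp.memLp U.2) hDf
  have hn : ContinuousOn (fun x => innerSL ℝ (A (outwardNormal Ω x))) (frontier Ω) :=
    (innerSL ℝ).continuous.comp_continuousOn
      (A.continuous.comp_continuousOn hΩ.continuousOn_outwardNormal)
  obtain ⟨C, hC⟩ := hΩ.isCompact_frontier.exists_bound_of_continuousOn hn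
  have h2 : Tendsto (fun k => ∫ x, inner ℝ (A (outwardNormal Ω x)) (f k x) ∂(surfaceMeasure Ω))
      atTop (𝓝 (∫ x, inner ℝ (A (outwardNormal Ω x)) (g x) ∂(surfaceMeasure Ω))) :=
    tendsto_integral_of_tendsto_eLpNorm_two
      (T := fun x => innerSL ℝ (A (outwardNormal Ω x))) (C := C)
      (IsSmoothBoundedDomain.aestronglyMeasurable_surfaceMeasure hn)
      (IsSmoothBoundedDomain.ae_mem_frontier.mono fun x hx => hC x hx)
      (fun k => hΩ.memLp_surfaceMeasure (hf k).continuous.continuousOn) (Lp.memLp g) hfg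
  -- The identity holds for the smooth approximants; both sides converge, so it passes to the weak
  -- Jacobian and the trace. The shape operator term is the same boundary integral with the opposite
  -- sign.
  have h3 : ∀ k, ∫ x in Ω, frobenius A (fderiv ℝ (f k) x) =
      ∫ x, inner ℝ (A (outwardNormal Ω x)) (f k x) ∂(surfaceMeasure Ω) := by
    intro k
    rw [hΩ.integral_frobenius_antisymmetric hA (hf k)]
    simp only [real_inner_comm]
  simp only [h3] at h1
  have h4 := tendsto_nhds_unique h1 h2
  have h5 : ∀ x, fderiv ℝ (fun x => A x + b) x = A := fun x => (hasFDerivAt_affine A b x).fderiv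
  rw [viscousForm]
  simp only [h5, h4]
  rw [add_eq_zero_iff_eq_neg, ← integral_neg]
  refine integral_congr_ae ?_
  filter_upwards [IsSmoothBoundedDomain.ae_mem_frontier] with x hx
  rw [zero_smul, zero_sub, inner_neg_right, inner_shapeOperator_rigid hΩ hA ht hx, neg_neg,
    real_inner_comm]

/-- The viscous form of a tangent infinitesimal rigid motion vanishes on tangent fields. -/
theorem viscousForm_rigid_right
    (ht : ∀ x ∈ frontier Ω, (inner ℝ (A x + b) (outwardNormal Ω x) : ℝ) = 0)
    {U : L2 Ω × L2Mat Ω} {g : Lp E3 2 (surfaceMeasure Ω)}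
    (hU : ∀ᵐ x ∂(volume.restrict Ω), U.2 x = A)
    (hg : ∀ᵐ x ∂(surfaceMeasure Ω), g x = A x + b) {Φ : E3 → E3} (hΦ : ContDiff ℝ ∞ Φ)
    (hΦt : ∀ x ∈ frontier Ω, (inner ℝ (Φ x) (outwardNormal Ω x) : ℝ) = 0) :
    viscousForm Ω (fun _ => 0) Φ U g = 0 := by
  have h1 : ∫ x in Ω, frobenius (fderiv ℝ Φ x) (U.2 x) =
      ∫ x, inner ℝ (Φ x) (A (outwardNormal Ω x)) ∂(surfaceMeasure Ω) := by
    rw [← hΩ.integral_frobenius_antisymmetric hA hΦ]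
    refine integral_congr_ae ?_
    filter_upwards [hU] with x hx
    rw [hx, frobenius_comm]
  rw [viscousForm, h1, add_eq_zero_iff_eq_neg, ← integral_neg]
  refine integral_congr_ae ?_
  filter_upwards [IsSmoothBoundedDomain.ae_mem_frontier, hg] with x hx hgx
  rw [hgx, zero_smul, zero_sub, inner_neg_right,
    -- Tangency of both fields allows the shape operator to be moved onto Φ.
    hΩ.inner_shapeOperator_symm hx (hΦt x hx) (ht x hx), inner_shapeOperator_rigid hΩ hA ht hx,
    neg_neg]

/-- The convective term of a tangent infinitesimal rigid motion vanishes on solenoidal tangent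
fields. -/
theorem integral_convective_rigid
    (ht : ∀ x ∈ frontier Ω, (inner ℝ (A x + b) (outwardNormal Ω x) : ℝ) = 0)
    {Φ : E3 → E3} (hΦ : ContDiff ℝ ∞ Φ) (hdiv : ∀ x ∈ Ω, divergence Φ x = 0)
    (hΦt : ∀ x ∈ frontier Ω, (inner ℝ (Φ x) (outwardNormal Ω x) : ℝ) = 0) :
    ∫ x in Ω, inner ℝ (fderiv ℝ Φ x (A x + b)) (A x + b) = 0 := by
  set W : E3 → E3 := fun x => A x + b
  have hW : ContDiff ℝ ∞ W := contDiff_affine A b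
  have hWd : ∀ x, HasFDerivAt W A x := hasFDerivAt_affine A b
  -- Two orthogonality relations are combined: W against the gradient of Φ · W, and Φ against the
  -- gradient of |W|², which by antisymmetry gives ∫ Φ · AW = 0.
  have h1 := hΩ.integral_fderiv_eq_zero_of_tangent (hΦ.inner ℝ hW) hW
    (fun x _ => hA.divergence_affine b x) ht
  have h2 := hΩ.integral_fderiv_eq_zero_of_tangent (hW.inner ℝ hW) hΦ hdiv hΦt
  have e1 : ∀ x, fderiv ℝ (fun x => (inner ℝ (Φ x) (W x) : ℝ)) x (W x) =
      inner ℝ (Φ x) (A (W x)) + inner ℝ (fderiv ℝ Φ x (W x)) (W x) := by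
    intro x
    rw [fderiv_inner_apply ℝ (hΦ.differentiable (by simp) x) (hWd x).differentiableAt,
      (hWd x).fderiv]
  have e2 : ∀ x, fderiv ℝ (fun x => (inner ℝ (W x) (W x) : ℝ)) x (Φ x) =
      -2 * inner ℝ (Φ x) (A (W x)) := by
    intro x
    rw [fderiv_inner_apply ℝ (hWd x).differentiableAt (hWd x).differentiableAt, (hWd x).fderiv,
      real_inner_comm (A (Φ x)) (W x), hA]
    ring
  have hc1 : Continuous fun x => (inner ℝ (Φ x) (A (W x)) : ℝ) :=
    hΦ.continuous.inner (A.continuous.comp hW.continuous)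
  have hc2 : Continuous fun x => (inner ℝ (fderiv ℝ Φ x (W x)) (W x) : ℝ) :=
    ((hΦ.continuous_fderiv (by simp)).clm_apply hW.continuous).inner hW.continuous
  simp only [e2] at h2
  rw [integral_const_mul] at h2
  simp only [e1] at h1
  rw [integral_add (hΩ.integrableOn_of_continuous hc1) (hΩ.integrableOn_of_continuous hc2)] at h1
  linarith

end RigidFields

/-! ### Stationary weak solutions. -/

theorem hasWeakJacobian_affine {Ω : Set E3} {A : E3 →L[ℝ] E3} {b : E3} {w : L2 Ω}
    (hw : ∀ᵐ x ∂(volume.restrict Ω), w x = A x + b) {G : L2Mat Ω}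
    (hG : ∀ᵐ x ∂(volume.restrict Ω), G x = A) : HasWeakJacobian Ω w G := by
  intro φ hφ hc hs v
  have h1 : ∫ x in Ω, fderiv ℝ φ x v • w x = ∫ x, fderiv ℝ φ x v • (A x + b) := by
    refine Eq.trans (integral_congr_ae ?_) (setIntegral_eq_integral_of_forall_compl_eq_zero
      (s := Ω) (f := fun x => fderiv ℝ φ x v • (A x + b)) fun x hx => ?_)
    · filter_upwards [hw] with x hx
      rw [hx]
    · beta_reduce
      rw [image_eq_zero_of_notMem_tsupport fun h => hx (hs (tsupport_fderiv_subset ℝ h))]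
      simp
  have h2 : ∫ x in Ω, φ x • G x v = ∫ x, φ x • A v := by
    refine Eq.trans (integral_congr_ae ?_) (setIntegral_eq_integral_of_forall_compl_eq_zero
      (s := Ω) (f := fun x => φ x • A v) fun x hx => ?_)
    · filter_upwards [hG] with x hx
      rw [hx]
    · beta_reduce
      rw [image_eq_zero_of_notMem_tsupport fun h => hx (hs h), zero_smul]
  have hd : ∀ x, fderiv ℝ (fun x => A x + b) x = A := fun x => (hasFDerivAt_affine A b x).fderiv
  have hcW := (contDiff_affine A b).continuous
  have hcφ' : Continuous fun x => fderiv ℝ φ x v :=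
    (hφ.continuous_fderiv (by simp)).clm_apply continuous_const
  have h3 := integral_smul_fderiv_eq_neg_fderiv_smul_of_integrable (μ := (volume : Measure E3))
    (f := φ) (g := fun x => A x + b) (v := v)
    ((hcφ'.smul hcW).integrable_of_hasCompactSupport (hc.fderiv_apply ℝ v).smul_right)
    (by
      simp only [hd]
      exact (hφ.continuous.smul continuous_const).integrable_of_hasCompactSupport hc.smul_right)
    ((hφ.continuous.smul hcW).integrable_of_hasCompactSupport hc.smul_right)
    (fun x _ => hφ.differentiable (by simp) x) (fun x _ => (hasFDerivAt_affine A b x).differentiableAt)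
  simp only [hd] at h3
  rw [h1, h2, h3, neg_neg]

/-- Every clause involves only times t ≥ 0. Values at negative times are unconstrained, so the
projected solution is known to be constant only there. -/
theorem IsWeakSolution.congr {Ω : Set E3} {ν : ℝ} {α : E3 → ℝ} {u₀ : L2 Ω} {u u' : ℝ → L2 Ω}
    (h : IsWeakSolution Ω ν α u₀ u) (huu' : ∀ t, 0 ≤ t → u' t = u t) :
    IsWeakSolution Ω ν α u₀ u' where
  initial_mem := h.initial_mem
  mem t ht := huu' t ht ▸ h.mem t ht
  weakly_continuous w := (h.weakly_continuous w).congr fun t ht => by rw [huu' t ht]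
  locally_bounded T hT := by
    obtain ⟨C, hC⟩ := h.locally_bounded T hT
    refine ⟨C, ?_⟩
    filter_upwards [hC, ae_restrict_mem measurableSet_Ico] with t ht htT
    rwa [huu' t htT.1]
  time_derivative := by
    obtain ⟨F, hF, hF'⟩ := h.time_derivative
    refine ⟨F, hF, fun η hη hc hs V => ?_⟩
    rw [← hF' η hη hc hs V]
    refine setIntegral_congr_fun measurableSet_Ioi fun t (ht : 0 < t) => ?_
    beta_reduce
    rw [huu' t ht.le]
  weak_form := by
    obtain ⟨U, g, h1, h2, h3, h4⟩ := h.weak_form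
    refine ⟨U, g, ?_, h2, h3, fun Φ hΦ => ⟨(h4 Φ hΦ).1, ?_⟩⟩
    · filter_upwards [h1, ae_restrict_mem measurableSet_Ioi] with t ht (ht0 : 0 < t)
      rw [ht, huu' t ht0.le]
    · rw [← (h4 Φ hΦ).2]
      congr 1
      refine setIntegral_congr_fun measurableSet_Ioi fun t (ht : 0 < t) => ?_
      beta_reduce
      rw [huu' t ht.le]

/-- Exchange the integrals and integrate in time: the contribution at late times vanishes, leaving
the one at 0. For a stationary field this cancels the initial term of the weak formulation. -/
theorem integral_Ioi_integral_deriv_inner {Ω : Set E3} (hΩ : IsSmoothBoundedDomain Ω)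
    {Φ : ℝ → E3 → E3} (hΦ : ContDiff ℝ ∞ (fun q : ℝ × E3 => Φ q.1 q.2)) {T : ℝ}
    (hT : ∀ t, T ≤ t → ∀ x, Φ t x = 0) {W : E3 → E3} (hW : Continuous W) :
    ∫ t in Set.Ioi (0 : ℝ), ∫ x in Ω, inner ℝ (deriv (fun s => Φ s x) t) (W x) =
      -∫ x in Ω, inner ℝ (Φ 0 x) (W x) := by
  have hd : ∀ t x, HasDerivAt (fun s => Φ s x)
      (fderiv ℝ (fun q : ℝ × E3 => Φ q.1 q.2) (t, x) (1, 0)) t := by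
    intro t x
    have := (hΦ.differentiable (by simp) (t, x)).hasFDerivAt.comp_hasDerivAt t
      ((hasDerivAt_id t).prodMk (hasDerivAt_const t x))
    exact this
  set D : ℝ → E3 → E3 := fun t x => fderiv ℝ (fun q : ℝ × E3 => Φ q.1 q.2) (t, x) (1, 0)
  have hDc : Continuous fun q : ℝ × E3 => D q.1 q.2 :=
    (hΦ.continuous_fderiv (by simp)).clm_apply continuous_const
  have hFc : Continuous fun q : ℝ × E3 => (inner ℝ (D q.1 q.2) (W q.2) : ℝ) :=
    hDc.inner (hW.comp continuous_snd)
  simp only [fun t x => (hd t x).deriv]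
  -- A nonnegative time strictly beyond T, so that Φ vanishes near every later time and its time
  -- derivative does too.
  set S : ℝ := max T 0 + 1
  have hS0 : 0 ≤ S := by positivity
  have hTS : T < S := (le_max_left T 0).trans_lt (lt_add_one _)
  have hzero : ∀ t, S < t → ∀ x, D t x = 0 := by
    intro t ht x
    refine (hd t x).unique ((hasDerivAt_const t (0 : E3)).congr_of_eventuallyEq ?_)
    filter_upwards [Ioi_mem_nhds (hTS.trans ht)] with s hs
    exact hT s (le_of_lt hs) x
  have h1 : ∫ t in Set.Ioi (0 : ℝ), ∫ x in Ω, inner ℝ (D t x) (W x) =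
      ∫ t in Set.Ioc 0 S, ∫ x in Ω, inner ℝ (D t x) (W x) := by
    refine setIntegral_eq_of_subset_of_forall_sdiff_eq_zero measurableSet_Ioi
      (fun t ht => ht.1) fun t ht => ?_
    have : S < t := not_le.1 fun h => ht.2 ⟨ht.1, h⟩
    simp [hzero t this]
  rw [h1, integral_integral_swap, ← integral_neg]
  · refine integral_congr_ae (Eventually.of_forall fun x => ?_)
    beta_reduce
    rw [← intervalIntegral.integral_of_le hS0,
      intervalIntegral.integral_eq_sub_of_hasDerivAt (f := fun t => (inner ℝ (Φ t x) (W x) : ℝ)),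
      hT S hTS.le]
    · simp
    · intro t _
      simpa using (hd t x).inner ℝ (hasDerivAt_const t (W x))
    · exact (hFc.comp (by fun_prop : Continuous fun t : ℝ => (t, x))).intervalIntegrable _ _
  · rw [Measure.prod_restrict]
    have hK : IsCompact (Set.Icc 0 S ×ˢ closure Ω) := isCompact_Icc.prod hΩ.isCompact_closure
    exact (hFc.continuousOn.integrableOn_compact hK).mono_set
      (Set.prod_mono Set.Ioc_subset_Icc_self subset_closure)

theorem IsTestField.contDiff_slice {Ω : Set E3} {Φ : ℝ → E3 → E3} (hΦ : IsTestField Ω Φ) (t : ℝ) :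
    ContDiff ℝ ∞ (Φ t) :=
  hΦ.smooth.comp (contDiff_prodMk_right t)

theorem isBoundaryTrace_affine {Ω : Set E3} {A : E3 →L[ℝ] E3} {b : E3} {U : L2 Ω × L2Mat Ω}
    {g : Lp E3 2 (surfaceMeasure Ω)} (hU : ∀ᵐ x ∂(volume.restrict Ω), U.1 x = A x + b)
    (hDU : ∀ᵐ x ∂(volume.restrict Ω), U.2 x = A)
    (hg : ∀ᵐ x ∂(surfaceMeasure Ω), g x = A x + b) : IsBoundaryTrace Ω U g := by
  have h1 : eLpNorm (fun x => A x + b - U.1 x) 2 (volume.restrict Ω) = 0 := by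
    refine eLpNorm_eq_zero_of_ae_zero ?_
    filter_upwards [hU] with x hx
    rw [hx, sub_self, Pi.zero_apply]
  have h2 : eLpNorm (fun x => fderiv ℝ (fun x => A x + b) x - U.2 x) 2 (volume.restrict Ω) = 0 := by
    refine (eLpNorm_congr_norm_ae (g := fun _ : E3 => (0 : ℝ)) ?_).trans eLpNorm_zero
    filter_upwards [hDU] with x hx
    rw [hx, (hasFDerivAt_affine A b x).fderiv, sub_self, norm_zero, norm_zero]
  have h3 : eLpNorm (fun x => A x + b - g x) 2 (surfaceMeasure Ω) = 0 := by
    refine eLpNorm_eq_zero_of_ae_zero ?_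
    filter_upwards [hg] with x hx
    rw [hx, sub_self, Pi.zero_apply]
  refine ⟨fun _ x => A x + b, fun _ => contDiff_affine A b, ?_, ?_, ?_⟩
  · simp only [h1, tendsto_const_nhds]
  · simp only [h2, tendsto_const_nhds]
  · simp only [h3, tendsto_const_nhds]

theorem memLp_zero_dual (H : Type*) [NormedAddCommGroup H] [NormedSpace ℝ H] (q : ℝ≥0∞)
    (μ : Measure ℝ) : MemLp (fun _ : ℝ => (0 : H →L[ℝ] ℝ)) q μ :=
  MemLp.zero' (ε := H →L[ℝ] ℝ)

theorem hasTimeDerivative_const {Ω : Set E3} (w : L2 Ω) : HasTimeDerivative Ω fun _ => w := by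
  refine ⟨fun _ => 0, fun a b _ _ => ?_, fun η hη hc hs V => ?_⟩
  · exact memLp_zero_dual _ _ _
  -- The support of η lies in the open half-line, so no boundary term arises at time 0.
  · have h0 : η 0 = 0 := image_eq_zero_of_notMem_tsupport fun h => lt_irrefl (0 : ℝ) (hs h)
    rw [integral_mul_const, hc.integral_Ioi_deriv_eq (hη.of_le (by simp)), h0]
    simp

/-- The elements of `Ker S` are stationary solutions. -/
theorem isWeakSolution_of_mem_kerS {Ω : Set E3} (hΩ : IsSmoothBoundedDomain Ω) (ν : ℝ) {w : L2 Ω}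
    (hw : w ∈ kerS Ω) : IsWeakSolution Ω ν (fun _ => 0) w (fun _ => w) := by
  obtain ⟨A, hA, b, hwA⟩ := exists_affine_of_mem_kerS hΩ hw
  have ht := tangent_of_mem_kerS hΩ hA hw hwA
  have := hΩ.isFiniteMeasure_restrict
  have hWs := contDiff_affine A b
  have hGm : MemLp (fun _ : E3 => A) 2 (volume.restrict Ω) := memLp_const A
  have hgm : MemLp (fun x => A x + b) 2 (surfaceMeasure Ω) :=
    hΩ.memLp_surfaceMeasure hWs.continuous.continuousOn
  have hG : ∀ᵐ x ∂(volume.restrict Ω), hGm.toLp _ x = A := hGm.coeFn_toLp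
  have hg : ∀ᵐ x ∂(surfaceMeasure Ω), hgm.toLp _ x = A x + b := hgm.coeFn_toLp
  let U : H1SigmaTan Ω := ⟨(w, hGm.toLp _), hw.1, hasWeakJacobian_affine hwA hG⟩
  have htrace : IsBoundaryTrace Ω U.1 (hgm.toLp _) := isBoundaryTrace_affine hwA hG hg
  refine ⟨hw.1, fun _ _ => hw.1, fun _ => continuousOn_const, fun T _ => ⟨‖w‖, by simp⟩, ?_, ?_⟩
  · exact hasTimeDerivative_const w
  · refine ⟨fun _ => U, fun _ => hgm.toLp _, Eventually.of_forall fun _ => rfl,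
      fun _ _ _ _ => memLp_const U, Eventually.of_forall fun _ => htrace, fun Φ hΦ => ?_⟩
    have hvisc : ∀ t ∈ Set.Ioi (0 : ℝ),
        viscousForm Ω (fun _ => 0) (Φ t) U.1 (hgm.toLp _) = 0 := fun t h =>
      viscousForm_rigid_right hΩ hA ht hG hg (hΦ.contDiff_slice t)
        (hΦ.tangent t (le_of_lt h))
    refine ⟨integrableOn_zero.congr_fun (fun t h => (hvisc t h).symm) measurableSet_Ioi, ?_⟩
    rw [setIntegral_congr_fun measurableSet_Ioi hvisc, integral_zero, mul_zero]
    obtain ⟨T, hT⟩ := hΦ.support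
    have hinit : ∫ x in Ω, inner ℝ (Φ 0 x) (w x) = ∫ x in Ω, inner ℝ (Φ 0 x) (A x + b) := by
      refine integral_congr_ae ?_
      filter_upwards [hwA] with x hx
      rw [hx]
    have hslice : ∀ t ∈ Set.Ioi (0 : ℝ), ∫ x in Ω, (inner ℝ (deriv (fun s => Φ s x) t) (w x) +
        inner ℝ (fderiv ℝ (Φ t) x (w x)) (w x)) =
        ∫ x in Ω, inner ℝ (deriv (fun s => Φ s x) t) (A x + b) := by
      intro t htpos
      have htpos' : 0 ≤ t := le_of_lt htpos
      have hΦs := hΦ.contDiff_slice t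
      have hderiv : ∀ x, deriv (fun s => Φ s x) t =
          fderiv ℝ (fun q : ℝ × E3 => Φ q.1 q.2) (t, x) (1, 0) := fun x => by
        have := (hΦ.smooth.differentiable (by simp) (t, x)).hasFDerivAt.comp_hasDerivAt t
          ((hasDerivAt_id t).prodMk (hasDerivAt_const t x))
        exact this.deriv
      have hc1 : Continuous fun x => (inner ℝ (deriv (fun s => Φ s x) t) (A x + b) : ℝ) := by
        simp only [hderiv]
        have h1 := hΦ.smooth.continuous_fderiv (by simp)
        exact ((h1.comp (by fun_prop : Continuous fun x : E3 => (t, x))).clm_apply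
          continuous_const).inner hWs.continuous
      have hc2 : Continuous fun x => (inner ℝ (fderiv ℝ (Φ t) x (A x + b)) (A x + b) : ℝ) :=
        ((hΦs.continuous_fderiv (by simp)).clm_apply hWs.continuous).inner hWs.continuous
      have hcongr : ∫ x in Ω, (inner ℝ (deriv (fun s => Φ s x) t) (w x) +
          inner ℝ (fderiv ℝ (Φ t) x (w x)) (w x)) =
          ∫ x in Ω, (inner ℝ (deriv (fun s => Φ s x) t) (A x + b) +
          inner ℝ (fderiv ℝ (Φ t) x (A x + b)) (A x + b)) := by
        refine integral_congr_ae ?_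
        filter_upwards [hwA] with x hx
        rw [hx]
      rw [hcongr, integral_add (hΩ.integrableOn_of_continuous hc1)
        (hΩ.integrableOn_of_continuous hc2), integral_convective_rigid hΩ hA ht hΦs
        (hΦ.solenoidal t htpos') (hΦ.tangent t htpos'), add_zero]
    rw [setIntegral_congr_fun measurableSet_Ioi hslice, hinit,
      integral_Ioi_integral_deriv_inner hΩ hΦ.smooth hT hWs.continuous, neg_add_cancel]

/-! ### Conservation of the component along Ker S. -/

/-- The components of a weak solution along `Ker S` are constant in time. -/
theorem IsWeakSolution.inner_kerS_eq {Ω : Set E3} (hΩ : IsSmoothBoundedDomain Ω) {ν : ℝ}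
    {u₀ : L2 Ω} {u : ℝ → L2 Ω} (hu : IsWeakSolution Ω ν (fun _ => 0) u₀ u) {w : L2 Ω}
    (hw : w ∈ kerS Ω) {t : ℝ} (ht0 : 0 ≤ t) :
    (inner ℝ w (u t) : ℝ) = inner ℝ w u₀ := by
  obtain ⟨A, hA, b, hwA⟩ := exists_affine_of_mem_kerS hΩ hw
  have ht := tangent_of_mem_kerS hΩ hA hw hwA
  have hWs := contDiff_affine A b
  obtain ⟨U, g, -, -, htr, hweak⟩ := hu.weak_form
  have hinner : ∀ v : L2 Ω, (inner ℝ w v : ℝ) = ∫ x in Ω, inner ℝ (A x + b) (v x) := by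
    intro v
    rw [L2.inner_def]
    refine integral_congr_ae ?_
    filter_upwards [hwA] with x hx
    rw [hx]
  have key : ∀ ψ : ℝ → ℝ, ContDiff ℝ ∞ ψ → HasCompactSupport ψ → tsupport ψ ⊆ Set.Ioi 0 →
      ∫ s, ψ s • ((inner ℝ w (u s) : ℝ) - inner ℝ w u₀) = 0 := by
    intro ψ hψ hψc hψs
    obtain ⟨T, hT0, hT⟩ : ∃ T : ℝ, 0 < T ∧ ∀ s, T ≤ s → ψ s = 0 := by
      obtain ⟨R, hR⟩ := hψc.isCompact.isBounded.subset_closedBall 0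
      refine ⟨max R 0 + 1, by positivity, fun s hs => image_eq_zero_of_notMem_tsupport fun h => ?_⟩
      have := hR h
      rw [mem_closedBall_zero_iff, Real.norm_eq_abs] at this
      linarith [le_abs_self s, le_max_left R 0]
    -- The antiderivative based at T vanishes from T on, as a test field requires, while η(0) = -∫ψ
    -- brings in the initial velocity.
    set η : ℝ → ℝ := fun t => ∫ s in T..t, ψ s
    have hηd : ∀ t, HasDerivAt η (ψ t) t := fun t =>
      intervalIntegral.integral_hasDerivAt_right (hψ.continuous.intervalIntegrable _ _)
        hψ.continuous.aestronglyMeasurable.stronglyMeasurableAtFilter hψ.continuous.continuousAt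
    have hη : ContDiff ℝ ∞ η := by
      refine contDiff_infty_iff_deriv.2 ⟨fun t => (hηd t).differentiableAt, ?_⟩
      rwa [funext fun t => (hηd t).deriv]
    have hηT : ∀ t, T ≤ t → η t = 0 := fun t htT => by
      refine (intervalIntegral.integral_congr (g := fun _ => (0 : ℝ)) fun s hs => ?_).trans
        intervalIntegral.integral_zero
      rw [Set.uIcc_of_le htT] at hs
      exact hT s hs.1
    have hη0 : η 0 = -∫ s in Set.Ioi (0 : ℝ), ψ s := by
      simp only [η]
      rw [intervalIntegral.integral_symm, intervalIntegral.integral_of_le hT0.le,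
        setIntegral_eq_of_subset_of_forall_sdiff_eq_zero measurableSet_Ioi
          (s := Set.Ioc 0 T) (fun s hs => hs.1) fun s hs => hT s
          (le_of_lt (not_le.1 fun h => hs.2 ⟨hs.1, h⟩))]
    -- Written so that each time slice is literally an affine map with antisymmetric linear part, to
    -- which the results on rigid fields apply.
    set Φ : ℝ → E3 → E3 := fun t x => (η t • A) x + η t • b
    have hΦeq : ∀ t x, Φ t x = η t • (A x + b) := fun t x => by simp [Φ]
    have hΦ : IsTestField Ω Φ := by
      refine ⟨?_, ⟨T, fun t htT x => by rw [hΦeq, hηT t htT, zero_smul]⟩,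
        fun t _ x _ => (hA.smul (η t)).divergence_affine _ x, fun t _ x hx => ?_⟩
      · simp only [hΦeq]
        exact (hη.comp contDiff_fst).smul (hWs.comp contDiff_snd)
      · rw [hΦeq, inner_smul_left, ht x hx, mul_zero]
    obtain ⟨-, heq⟩ := hweak Φ hΦ
    have hvisc : ∫ t in Set.Ioi (0 : ℝ), viscousForm Ω (fun _ => 0) (Φ t) (U t).1 (g t) = 0 := by
      refine integral_eq_zero_of_ae ?_
      filter_upwards [htr] with t htrt
      refine viscousForm_rigid_left hΩ (hA.smul (η t)) (fun x hx => ?_) htrt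
      have := hΦeq t x
      simp only [Φ] at this
      rw [this, inner_smul_left, ht x hx, mul_zero]
    -- The convective integrand is η Au · u, zero pointwise by antisymmetry, whatever u is.
    have hslice : ∀ t, ∫ x in Ω, (inner ℝ (deriv (fun s => Φ s x) t) (u t x) +
        inner ℝ (fderiv ℝ (Φ t) x (u t x)) (u t x)) = ψ t * inner ℝ w (u t) := by
      intro t
      rw [hinner, ← integral_const_mul]
      refine integral_congr_ae (Eventually.of_forall fun x => ?_)
      have h1 : deriv (fun s => Φ s x) t = ψ t • (A x + b) := by
        simp only [hΦeq]
        exact ((hηd t).smul_const _).deriv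
      have h2 : fderiv ℝ (Φ t) x = η t • A := (hasFDerivAt_affine (η t • A) (η t • b) x).fderiv
      beta_reduce
      rw [h1, h2, (hA.smul (η t)).inner_self, add_zero, inner_smul_left]
      simp
    have hinit : ∫ x in Ω, inner ℝ (Φ 0 x) (u₀ x) = η 0 * inner ℝ w u₀ := by
      rw [hinner, ← integral_const_mul]
      refine integral_congr_ae (Eventually.of_forall fun x => ?_)
      beta_reduce
      rw [hΦeq, inner_smul_left]
      simp
    rw [hvisc, mul_zero, hinit, hη0] at heq
    simp only [hslice] at heq
    have hsupp : ∀ s ∉ Set.Ioi (0 : ℝ), ψ s = 0 := fun s hs =>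
      image_eq_zero_of_notMem_tsupport fun h => hs (hψs h)
    have hcontOn : ContinuousOn (fun s => (inner ℝ w (u s) : ℝ)) (Set.Ici 0) :=
      hu.weakly_continuous w
    have hi1 : IntegrableOn (fun s => ψ s * inner ℝ w (u s)) (Set.Ioi 0) volume := by
      have h1 : IntegrableOn (fun s => ψ s * inner ℝ w (u s)) (Set.Icc 0 T) volume :=
        (hψ.continuous.continuousOn.mul
          (hcontOn.mono Set.Icc_subset_Ici_self)).integrableOn_compact isCompact_Icc
      refine h1.of_forall_sdiff_eq_zero measurableSet_Ioi fun s hs => ?_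
      have : T ≤ s := le_of_lt (not_le.1 fun h => hs.2 ⟨le_of_lt hs.1, h⟩)
      rw [hT s this, zero_mul]
    have hi2 : IntegrableOn (fun s => ψ s * (inner ℝ w u₀ : ℝ)) (Set.Ioi 0) volume :=
      ((hψ.continuous.integrable_of_hasCompactSupport hψc).mul_const _).integrableOn
    rw [← setIntegral_eq_integral_of_forall_compl_eq_zero (s := Set.Ioi 0) fun s hs => by
      rw [hsupp s hs, zero_smul]]
    simp only [smul_eq_mul, mul_sub]
    rw [integral_sub hi1 hi2, integral_mul_const]
    linarith
  have hcont : ContinuousOn (fun s => (inner ℝ w (u s) : ℝ) - inner ℝ w u₀) (Set.Ici 0) :=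
    (hu.weakly_continuous w).sub continuousOn_const
  -- The fundamental lemma gives equality for almost every t > 0; weak continuity extends it first
  -- to all t > 0 and then to t = 0.
  have hae := isOpen_Ioi.ae_eq_zero_of_integral_contDiff_smul_eq_zero
    ((hcont.mono Set.Ioi_subset_Ici_self).locallyIntegrableOn measurableSet_Ioi) key
  have hIoi : Set.EqOn (fun s => (inner ℝ w (u s) : ℝ) - inner ℝ w u₀) (fun _ => 0)
      (Set.Ioi 0) :=
    Measure.eqOn_open_of_ae_eq ((ae_restrict_iff' measurableSet_Ioi).2 hae) isOpen_Ioi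
      (hcont.mono Set.Ioi_subset_Ici_self) continuousOn_const
  have hIci := hIoi.of_subset_closure hcont continuousOn_const Set.Ioi_subset_Ici_self
    (by rw [closure_Ioi])
  exact sub_eq_zero.1 (hIci ht0)

theorem IsWeakSolution.projKerS_eq {Ω : Set E3} (hΩ : IsSmoothBoundedDomain Ω) {ν : ℝ}
    {u₀ : L2 Ω} {u : ℝ → L2 Ω} (hu : IsWeakSolution Ω ν (fun _ => 0) u₀ u) {t : ℝ} (ht : 0 ≤ t) :
    projKerS Ω (u t) = projKerS Ω u₀ := by
  rw [projKerS, projKerS, ← sub_eq_zero, ← map_sub, Submodule.starProjection_apply_eq_zero_iff,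
    Submodule.mem_orthogonal]
  intro w hw
  rw [inner_sub_right, hu.inner_kerS_eq hΩ hw ht, sub_self]

end NavierSlip

end

theorem proposition7p4 (Ω : Set NavierSlip.E3) (hΩ : NavierSlip.IsSmoothBoundedDomain Ω)
    (ν : ℝ) (hν : 0 < ν) :
    (∀ w ∈ NavierSlip.kerS Ω,
      NavierSlip.IsWeakSolution Ω ν (fun _ => 0) w (fun _ => w)) ∧
    ∀ (u₀ : NavierSlip.L2 Ω) (u : ℝ → NavierSlip.L2 Ω),
      NavierSlip.IsWeakSolution Ω ν (fun _ => 0) u₀ u →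
        (∀ t : ℝ, 0 ≤ t → NavierSlip.projKerS Ω (u t) = NavierSlip.projKerS Ω u₀) ∧
        NavierSlip.IsWeakSolution Ω ν (fun _ => 0) (NavierSlip.projKerS Ω u₀)
          (fun t => NavierSlip.projKerS Ω (u t)) := by
  refine ⟨fun w hw => NavierSlip.isWeakSolution_of_mem_kerS hΩ ν hw, fun u₀ u hu =>
    ⟨fun t ht => hu.projKerS_eq hΩ ht, ?_⟩⟩
  exact (NavierSlip.isWeakSolution_of_mem_kerS hΩ ν
    (Submodule.starProjection_apply_mem _ u₀)).congr fun t ht => hu.projKerS_eq hΩ ht
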